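/- Let $\mathscr{H}^2$ be the space of Dirichlet series $f(s)=\sum_{n=1}^\infty a_n n^{-s}$ with complex coefficients satisfying $\sum_{n=1}^\infty |a_n|^2<\infty$, regarded as analytic functions in the half-plane $\operatorname{Re} s>1/2$. Let $S=(\sigma_j+it_j)_j$ be a bounded (finite or infinite) sequence of not necessarily distinct points in the half-plane $\operatorname{Re} s>1/2$. Then there is a function $f\in\mathscr{H}^2$, not identically zero, that vanishes on $S$ (meaning that whenever a point occurs $n$ times in $S$, it is a zero of $f$ of order at least $n$) if and only if $\sum_j(\sigma_j-1/2)<\infty$. -/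

import Mathlib

/-- The Dirichlet-Hardy space `ℋ²`, as a class of functions on the half-plane `Re s > 1/2`
(the values of `f` elsewhere play no role): `f s = ∑_{n ≥ 1} a n * n ^ (-s)` for some
coefficients with `∑_{n ≥ 1} |a n| ^ 2 < ∞`. The value `a 0` is not used: the zeroth term of
Mathlib's L-series is `0` by definition. -/
def DirichletHardy : Set (ℂ → ℂ) :=
  {f | ∃ a : ℕ → ℂ, Summable (fun n : ℕ => ‖a (n + 1)‖ ^ 2) ∧
    ∀ s : ℂ, 1 / 2 < s.re → LSeriesHasSum a s (f s)}

/-- `f` is not identically zero on the half-plane `Re s > 1/2`. -/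
def NontrivialOnHalfPlane (f : ℂ → ℂ) : Prop :=
  ∃ s : ℂ, 1 / 2 < s.re ∧ f s ≠ 0

/-- `f` vanishes on the family `S`, with multiplicities: a point that occurs `n` times in `S`
is a zero of `f` of order at least `n`. -/
def VanishesOn {ι : Type*} (f : ℂ → ℂ) (S : ι → ℂ) : Prop :=
  ∀ z ∈ Set.range S, {j | S j = z}.encard ≤ analyticOrderAt f z

open Complex Metric Filter Topology ComplexConjugate Finset MeasureTheory
open scoped InnerProductSpace ENNReal

/-- The Szegő pairing of two finite combinations of Szegő kernels, weighted by `m`. -/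
noncomputable def szegoForm (s : Finset ℂ) (m : ℂ → ℂ) (c d : ℂ → ℂ) (r : ℝ) : ℂ :=
  ∑ z ∈ s, ∑ w ∈ s, c z * conj (d w) * (m (r ^ 2 * w) / (1 - conj z * (r ^ 2 * w)))

/-- A finite combination of Szegő kernels. -/
noncomputable def szegoSum (s : Finset ℂ) (c : ℂ → ℂ) (ζ : ℂ) : ℂ :=
  ∑ z ∈ s, c z * (1 / (1 - conj z * ζ))

lemma one_sub_conj_mul_ne_zero {z ζ : ℂ} (hz : ‖z‖ < 1) (hζ : ‖ζ‖ ≤ 1) :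
    1 - conj z * ζ ≠ 0 := by
  intro h
  have h1 : ‖conj z * ζ‖ = 1 := by rw [← sub_eq_zero.1 h]; simp
  rw [norm_mul, RCLike.norm_conj] at h1
  nlinarith [norm_nonneg z, norm_nonneg ζ]

lemma continuousOn_szegoSum {s : Finset ℂ} (hs : ∀ z ∈ s, ‖z‖ < 1) (c : ℂ → ℂ) :
    ContinuousOn (szegoSum s c) (closedBall 0 1) := by
  unfold szegoSum
  refine continuousOn_finsetSum _ fun z hz => ?_
  refine continuousOn_const.mul (continuousOn_const.div (by fun_prop) fun ζ hζ => ?_)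
  exact one_sub_conj_mul_ne_zero (hs z hz) (by simpa using hζ)

lemma circleAverage_szego {m : ℂ → ℂ} (hm : DifferentiableOn ℂ m (ball 0 1)) {r : ℝ}
    (hr : 0 < r) (hr1 : r < 1) {z w : ℂ} (hz : ‖z‖ < 1) (hw : ‖w‖ < 1) :
    Real.circleAverage (fun ζ => m ζ * (1 / (1 - conj z * ζ)) * conj (1 / (1 - conj w * ζ))) 0 r
      = m (r ^ 2 * w) / (1 - conj z * (r ^ 2 * w)) := by
  have hd : DifferentiableOn ℂ (fun ζ => m ζ * (1 / (1 - conj z * ζ))) (ball 0 1) := by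
    refine hm.mul (DifferentiableOn.div (by fun_prop) (by fun_prop) fun ζ hζ => ?_)
    exact one_sub_conj_mul_ne_zero hz (by simpa using (mem_ball_zero_iff.1 hζ).le)
  have hcl : DiffContOnCl ℂ (fun ζ => m ζ * (1 / (1 - conj z * ζ))) (ball 0 |r|) := by
    apply DifferentiableOn.diffContOnCl
    refine hd.mono ?_
    rw [abs_of_pos hr, closure_ball _ hr.ne']
    exact closedBall_subset_ball hr1
  have hrw : (r ^ 2 * w : ℂ) ∈ ball (0 : ℂ) |r| := by
    rw [mem_ball_zero_iff, abs_of_pos hr, norm_mul, norm_pow, norm_real, Real.norm_eq_abs,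
      abs_of_pos hr]
    nlinarith [norm_nonneg w, mul_pos hr hr]
  have key := hcl.circleAverage_smul_div hrw
  rw [← mul_one_div (m _), ← key]
  apply Real.circleAverage_congr_sphere
  intro ζ hζ
  rw [mem_sphere_zero_iff_norm, abs_of_pos hr] at hζ
  have hζ0 : ζ ≠ 0 := by rw [← norm_pos_iff, hζ]; exact hr
  have hc : conj ζ = r ^ 2 / ζ := by
    rw [eq_div_iff hζ0, mul_comm, mul_conj, normSq_eq_norm_sq, hζ]; push_cast; ring
  have hne : ζ - r ^ 2 * w ≠ 0 := by
    intro h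
    rw [sub_eq_zero] at h
    rw [mem_ball_zero_iff, ← h, hζ, abs_of_pos hr] at hrw
    exact lt_irrefl _ hrw
  simp only [map_div₀, map_sub, map_one, map_mul, conj_conj, hc, smul_eq_mul, sub_zero]
  have : 1 - w * (r ^ 2 / ζ) = (ζ - r ^ 2 * w) / ζ := by field_simp
  rw [this, one_div_div]
  ring

lemma circleAverage_szegoSum {m : ℂ → ℂ} (hm : DifferentiableOn ℂ m (ball 0 1)) {r : ℝ}
    (hr : 0 < r) (hr1 : r < 1) {s : Finset ℂ} (hs : ∀ z ∈ s, ‖z‖ < 1) (c d : ℂ → ℂ) :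
    Real.circleAverage (fun ζ => m ζ * szegoSum s c ζ * conj (szegoSum s d ζ)) 0 r
      = szegoForm s m c d r := by
  have hsub : sphere (0 : ℂ) |r| ⊆ ball 0 1 := by
    rw [abs_of_pos hr]; exact sphere_subset_closedBall.trans (closedBall_subset_ball hr1)
  have hint : ∀ z ∈ s, ∀ w ∈ s, CircleIntegrable (fun ζ => (c z * conj (d w)) •
      (m ζ * (1 / (1 - conj z * ζ)) * conj (1 / (1 - conj w * ζ)))) 0 r := by
    intro z hz w hw
    apply ContinuousOn.circleIntegrable'
    refine ContinuousOn.mono ?_ hsub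
    have h1 : ∀ z ∈ s, ContinuousOn (fun ζ => 1 / (1 - conj z * ζ)) (ball 0 1) := by
      intro z hz
      refine continuousOn_const.div (by fun_prop) fun ζ hζ => ?_
      exact one_sub_conj_mul_ne_zero (hs z hz) (by simpa using (mem_ball_zero_iff.1 hζ).le)
    have h2 := (hm.continuousOn.mul (h1 z hz)).mul (continuous_conj.comp_continuousOn (h1 w hw))
    exact h2.const_smul (c z * conj (d w))
  have hexp : (fun ζ => m ζ * szegoSum s c ζ * conj (szegoSum s d ζ)) =
      fun ζ => ∑ z ∈ s, ∑ w ∈ s, (c z * conj (d w)) •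
        (m ζ * (1 / (1 - conj z * ζ)) * conj (1 / (1 - conj w * ζ))) := by
    funext ζ
    simp only [szegoSum, map_sum, map_mul]
    rw [mul_assoc, Finset.sum_mul_sum, Finset.mul_sum]
    refine Finset.sum_congr rfl fun z _ => ?_
    rw [Finset.mul_sum]
    refine Finset.sum_congr rfl fun w _ => ?_
    rw [smul_eq_mul]; ring
  rw [hexp, Real.circleAverage_fun_sum fun z hz => CircleIntegrable.fun_sum _ fun w hw => hint z hz w hw,
    szegoForm]
  refine Finset.sum_congr rfl fun z hz => ?_
  rw [Real.circleAverage_fun_sum fun w hw => hint z hz w hw]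
  refine Finset.sum_congr rfl fun w hw => ?_
  rw [Real.circleAverage_fun_smul, circleAverage_szego hm hr hr1 (hs z hz) (hs w hw), smul_eq_mul]

lemma tendsto_szegoForm {m : ℂ → ℂ} (hm : DifferentiableOn ℂ m (ball 0 1))
    {s : Finset ℂ} (hs : ∀ z ∈ s, ‖z‖ < 1) (c d : ℂ → ℂ) :
    Tendsto (szegoForm s m c d) (𝓝[<] 1) (𝓝 (szegoForm s m c d 1)) := by
  apply ContinuousAt.continuousWithinAt
  unfold szegoForm
  refine tendsto_finsetSum _ fun z hz => tendsto_finsetSum _ fun w hw => ?_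
  have h1 : ContinuousAt (fun r : ℝ => (r ^ 2 * w : ℂ)) 1 := by fun_prop
  have h2 : ContinuousAt m (((1 : ℝ) : ℂ) ^ 2 * w) := by
    apply (hm.continuousOn).continuousAt
    apply isOpen_ball.mem_nhds
    simpa using hs w hw
  have h3 : ContinuousAt (fun r : ℝ => m (r ^ 2 * w : ℂ)) 1 :=
    ContinuousAt.comp (f := fun r : ℝ => (r ^ 2 * w : ℂ)) h2 h1
  refine ContinuousAt.mul continuousAt_const (h3.div (by fun_prop) ?_)
  simpa using one_sub_conj_mul_ne_zero (hs z hz) (hs w hw).le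

/-- Pick's inequality on the unit disc. -/
lemma szegoForm_le {m : ℂ → ℂ} (hm : DifferentiableOn ℂ m (ball 0 1)) {C : ℝ}
    (hC : ∀ z, ‖z‖ < 1 → ‖m z‖ ≤ C) {s : Finset ℂ} (hs : ∀ z ∈ s, ‖z‖ < 1) (d : ℂ → ℂ) :
    (szegoForm s 1 (fun z => conj (m z) * d z) (fun z => conj (m z) * d z) 1).re
      ≤ C ^ 2 * (szegoForm s 1 d d 1).re := by
  set c : ℂ → ℂ := fun z => conj (m z) * d z with hc
  have h1 : DifferentiableOn ℂ (1 : ℂ → ℂ) (ball 0 1) := differentiableOn_const 1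
  have hev : ∀ᶠ r : ℝ in 𝓝[<] 1, 0 ≤ (szegoForm s 1 c c r).re + C ^ 2 * (szegoForm s 1 d d r).re
      - 2 * (szegoForm s m c d r).re := by
    filter_upwards [Ioo_mem_nhdsLT (zero_lt_one' ℝ)] with r ⟨hr, hr1⟩
    have hsub : sphere (0 : ℂ) |r| ⊆ ball 0 1 := by
      rw [abs_of_pos hr]; exact sphere_subset_closedBall.trans (closedBall_subset_ball hr1)
    have hcont : ∀ (μ : ℂ → ℂ) (a b : ℂ → ℂ), DifferentiableOn ℂ μ (ball 0 1) →
        ContinuousOn (fun ζ => μ ζ * szegoSum s a ζ * conj (szegoSum s b ζ)) (sphere 0 |r|) := by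
      intro μ a b hμ
      refine ContinuousOn.mono ?_ hsub
      exact (hμ.continuousOn.mul ((continuousOn_szegoSum hs a).mono ball_subset_closedBall)).mul
        (continuous_conj.comp_continuousOn
          ((continuousOn_szegoSum hs b).mono ball_subset_closedBall))
    have hci : ∀ (μ : ℂ → ℂ) (a b : ℂ → ℂ), DifferentiableOn ℂ μ (ball 0 1) →
        CircleIntegrable (fun ζ => μ ζ * szegoSum s a ζ * conj (szegoSum s b ζ)) 0 r :=
      fun μ a b hμ => (hcont μ a b hμ).circleIntegrable'
    have hre : ∀ (μ : ℂ → ℂ) (a b : ℂ → ℂ), DifferentiableOn ℂ μ (ball 0 1) →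
        (szegoForm s μ a b r).re =
          Real.circleAverage (fun ζ => (μ ζ * szegoSum s a ζ * conj (szegoSum s b ζ)).re) 0 r := by
      intro μ a b hμ
      rw [← circleAverage_szegoSum hμ hr hr1 hs]
      exact ((reCLM.circleAverage_comp_comm (hci μ a b hμ))).symm
    have hri : ∀ (k : ℝ) (μ : ℂ → ℂ) (a b : ℂ → ℂ), DifferentiableOn ℂ μ (ball 0 1) →
        CircleIntegrable (fun ζ => k • (μ ζ * szegoSum s a ζ * conj (szegoSum s b ζ)).re) 0 r := by
      intro k μ a b hμ
      have h := (continuous_re.comp_continuousOn (hcont μ a b hμ)).const_smul k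
      exact ContinuousOn.circleIntegrable' h
    rw [hre 1 c c h1, hre 1 d d h1, hre m c d hm, ← one_smul ℝ (Real.circleAverage _ 0 r),
      ← smul_eq_mul (C ^ 2), ← smul_eq_mul (2 : ℝ),
      ← Real.circleAverage_fun_smul, ← Real.circleAverage_fun_smul, ← Real.circleAverage_fun_smul,
      ← Real.circleAverage_fun_add (hri _ 1 c c h1) (hri _ 1 d d h1),
      ← Real.circleAverage_fun_sub ((hri _ 1 c c h1).fun_add (hri _ 1 d d h1)) (hri _ m c d hm)]
    apply Real.circleAverage_nonneg_of_nonneg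
    intro ζ hζ
    have hmζ := hC ζ (by simpa using hsub hζ)
    set x := szegoSum s c ζ
    set y := szegoSum s d ζ
    have e1 : ∀ x : ℂ, ((1 : ℂ → ℂ) ζ * x * conj x).re = ‖x‖ ^ 2 := by
      intro x
      rw [Pi.one_apply, one_mul, mul_conj, normSq_eq_norm_sq, ofReal_re]
    have e2 : (m ζ * x * conj y).re ≤ C * ‖x‖ * ‖y‖ := by
      refine (re_le_norm _).trans ?_
      rw [norm_mul, norm_mul, RCLike.norm_conj]
      gcongr
    simp only [e1, smul_eq_mul]
    nlinarith [sq_nonneg (‖x‖ - C * ‖y‖)]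
  have hlim : ∀ (μ : ℂ → ℂ) (a b : ℂ → ℂ), DifferentiableOn ℂ μ (ball 0 1) →
      Tendsto (fun r => (szegoForm s μ a b r).re) (𝓝[<] 1) (𝓝 (szegoForm s μ a b 1).re) :=
    fun μ a b hμ => (continuous_re.tendsto _).comp (tendsto_szegoForm hμ hs a b)
  have h := ge_of_tendsto (((hlim 1 c c h1).add ((hlim 1 d d h1).const_mul (C ^ 2))).sub
    ((hlim m c d hm).const_mul 2)) hev
  have heq : szegoForm s m c d 1 = szegoForm s 1 c c 1 := by
    unfold szegoForm
    refine Finset.sum_congr rfl fun z hz => Finset.sum_congr rfl fun w hw => ?_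
    simp [hc]; ring
  rw [heq] at h
  linarith

/-- The Cayley transform from the right half-plane to the unit disc. -/
noncomputable def cayley (w : ℂ) : ℂ := (w - 1) / (w + 1)

/-- The inverse Cayley transform. -/
noncomputable def cayleyInv (z : ℂ) : ℂ := (1 + z) / (1 - z)

lemma add_one_ne_zero_of_re_pos {w : ℂ} (hw : 0 < w.re) : w + 1 ≠ 0 := by
  intro h
  have := congrArg re h
  simp at this
  linarith

lemma add_conj_ne_zero {w v : ℂ} (hw : 0 < w.re) (hv : 0 < v.re) : w + conj v ≠ 0 := by
  intro h
  have := congrArg re h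
  simp at this
  linarith

lemma cayleyInv_cayley {w : ℂ} (hw : 0 < w.re) : cayleyInv (cayley w) = w := by
  have h := add_one_ne_zero_of_re_pos hw
  have h1 : 1 - (w - 1) / (w + 1) = 2 / (w + 1) := by field_simp; ring
  have h2 : 1 + (w - 1) / (w + 1) = 2 * w / (w + 1) := by field_simp; ring
  rw [cayleyInv, cayley, h1, h2]
  field_simp

lemma norm_cayley_lt_one {w : ℂ} (hw : 0 < w.re) : ‖cayley w‖ < 1 := by
  have h := add_one_ne_zero_of_re_pos hw
  rw [cayley, norm_div, div_lt_one (norm_pos_iff.2 h)]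
  refine lt_of_pow_lt_pow_left₀ 2 (norm_nonneg _) ?_
  rw [← normSq_eq_norm_sq, ← normSq_eq_norm_sq, normSq_apply, normSq_apply]
  simp
  nlinarith

lemma one_sub_ne_zero_of_norm_lt {z : ℂ} (hz : ‖z‖ < 1) : 1 - z ≠ 0 := by
  intro h
  rw [← sub_eq_zero.1 h] at hz
  simp at hz

lemma cayleyInv_re_pos {z : ℂ} (hz : ‖z‖ < 1) : 0 < (cayleyInv z).re := by
  have h := one_sub_ne_zero_of_norm_lt hz
  have h1 : cayleyInv z = ((1 + z) * conj (1 - z)) / (normSq (1 - z) : ℂ) := by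
    have h2 : conj (1 - z) ≠ 0 := (map_ne_zero _).2 h
    rw [cayleyInv, ← mul_conj]
    field_simp
  rw [h1, div_ofReal_re]
  apply div_pos _ (normSq_pos.2 h)
  have h3 : ((1 + z) * conj (1 - z)).re = 1 - ‖z‖ ^ 2 := by
    rw [← normSq_eq_norm_sq, normSq_apply]
    simp
    ring
  rw [h3]
  nlinarith [norm_nonneg z]

/-- A family of vectors indexed by the right half-plane whose Gram matrix is the reproducing
kernel of the Hardy space. -/
def IsHardyKernel {E : Type*} [NormedAddCommGroup E] [InnerProductSpace ℂ E] (k : ℂ → E) : Prop :=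
  ∀ w v : ℂ, 0 < w.re → 0 < v.re → ⟪k w, k v⟫_ℂ = 1 / (w + conj v)

namespace IsHardyKernel

variable {E : Type*} [NormedAddCommGroup E] [InnerProductSpace ℂ E] {k : ℂ → E}

lemma norm_sum_sq (hk : IsHardyKernel k) {s : Finset ℂ} (hs : ∀ w ∈ s, 0 < w.re) (c : ℂ → ℂ) :
    ‖∑ w ∈ s, c w • k w‖ ^ 2 = (szegoForm (s.image cayley) 1
      (fun z => c (cayleyInv z) * ((1 - conj z) / (Real.sqrt 2 : ℂ)))
      (fun z => c (cayleyInv z) * ((1 - conj z) / (Real.sqrt 2 : ℂ))) 1).re := by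
  have hinj : Set.InjOn cayley s := fun w hw v hv h => by
    rw [← cayleyInv_cayley (hs w hw), h, cayleyInv_cayley (hs v hv)]
  rw [← inner_self_eq_norm_sq (𝕜 := ℂ), RCLike.re_eq_complex_re, szegoForm,
    Finset.sum_image hinj, sum_inner]
  simp_rw [Finset.sum_image hinj, inner_sum]
  rw [Finset.sum_comm]
  congr 1
  refine Finset.sum_congr rfl fun v hv => Finset.sum_congr rfl fun w hw => ?_
  rw [inner_smul_left, inner_smul_right, hk w v (hs w hw) (hs v hv), cayleyInv_cayley (hs w hw),
    cayleyInv_cayley (hs v hv)]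
  have h1 := add_one_ne_zero_of_re_pos (hs w hw)
  have h2 : conj v + 1 ≠ 0 := by
    rw [← map_one (starRingEnd ℂ), ← map_add]
    exact (map_ne_zero _).2 (add_one_ne_zero_of_re_pos (hs v hv))
  have h3 := add_conj_ne_zero (hs w hw) (hs v hv)
  have hsq : (Real.sqrt 2 : ℂ) * (Real.sqrt 2 : ℂ) = 2 := by
    rw [← ofReal_mul, Real.mul_self_sqrt (by norm_num)]; norm_num
  have hsq0 : (Real.sqrt 2 : ℂ) ≠ 0 := by
    intro h; rw [h] at hsq; norm_num at hsq
  simp only [cayley, map_mul, map_div₀, map_sub, map_add, map_one, conj_conj, conj_ofReal,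
    Pi.one_apply, ofReal_one, one_pow, one_mul]
  have e1 : 1 - (conj v - 1) / (conj v + 1) = 2 / (conj v + 1) := by field_simp; ring
  have e2 : 1 - (w - 1) / (w + 1) = 2 / (w + 1) := by field_simp; ring
  have e3 : 1 - (conj v - 1) / (conj v + 1) * ((w - 1) / (w + 1)) =
      2 * (w + conj v) / ((conj v + 1) * (w + 1)) := by field_simp; ring
  rw [e1, e2, e3]
  have e4 : c v * (2 / (conj v + 1) / (Real.sqrt 2 : ℂ)) *
      (conj (c w) * (2 / (w + 1) / (Real.sqrt 2 : ℂ))) *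
      (1 / (2 * (w + conj v) / ((conj v + 1) * (w + 1)))) =
      2 / ((Real.sqrt 2 : ℂ) * (Real.sqrt 2 : ℂ)) * (c v * conj (c w) * (1 / (w + conj v))) := by
    field_simp
  rw [e4, hsq]
  ring

lemma norm_sum_multiplier_le (hk : IsHardyKernel k) {m : ℂ → ℂ}
    (hm : DifferentiableOn ℂ m {w | 0 < w.re}) {C : ℝ} (hC0 : 0 ≤ C)
    (hC : ∀ w : ℂ, 0 < w.re → ‖m w‖ ≤ C) {s : Finset ℂ} (hs : ∀ w ∈ s, 0 < w.re) (d : ℂ → ℂ) :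
    ‖∑ w ∈ s, (conj (m w) * d w) • k w‖ ≤ C * ‖∑ w ∈ s, d w • k w‖ := by
  refine le_of_sq_le_sq ?_ (by positivity)
  rw [mul_pow, hk.norm_sum_sq hs, hk.norm_sum_sq hs]
  have hm' : DifferentiableOn ℂ (fun z => m (cayleyInv z)) (ball 0 1) := by
    refine hm.comp (t := {w : ℂ | 0 < w.re}) (f := cayleyInv) ?_ fun z hz => cayleyInv_re_pos (by simpa using hz)
    unfold cayleyInv
    refine DifferentiableOn.div (by fun_prop) (by fun_prop) fun z hz => ?_
    exact one_sub_ne_zero_of_norm_lt (by simpa using hz)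
  have hs' : ∀ z ∈ s.image cayley, ‖z‖ < 1 := by
    intro z hz
    obtain ⟨w, hw, rfl⟩ := Finset.mem_image.1 hz
    exact norm_cayley_lt_one (hs w hw)
  have h := szegoForm_le hm' (C := C) (fun z hz => hC _ (cayleyInv_re_pos hz)) hs'
    (fun z => d (cayleyInv z) * ((1 - conj z) / (Real.sqrt 2 : ℂ)))
  simpa only [mul_assoc] using h

/-- The multiplication operator by a bounded analytic function, determined by its action on the
reproducing kernels through its adjoint. -/
lemma exists_multiplier [CompleteSpace E] (hk : IsHardyKernel k) {m : ℂ → ℂ}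
    (hm : DifferentiableOn ℂ m {w | 0 < w.re}) {C : ℝ} (hC0 : 0 ≤ C)
    (hC : ∀ w : ℂ, 0 < w.re → ‖m w‖ ≤ C) :
    ∃ T : E →L[ℂ] E, ‖T‖ ≤ C ∧ ∀ w : ℂ, 0 < w.re → T (k w) = conj (m w) • k w := by
  let I := {w : ℂ // 0 < w.re}
  let e₀ : (I →₀ ℂ) →ₗ[ℂ] E := Finsupp.linearCombination ℂ fun w : I => k w
  let f : (I →₀ ℂ) →ₗ[ℂ] E := Finsupp.linearCombination ℂ fun w : I => conj (m w) • k w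
  let X := (LinearMap.range e₀).topologicalClosure
  have hX : ∀ x, e₀ x ∈ X := fun x => Submodule.le_topologicalClosure _ (LinearMap.mem_range_self _ x)
  let e : (I →₀ ℂ) →ₗ[ℂ] X := e₀.codRestrict X hX
  have hbound : ∀ x, ‖f x‖ ≤ C * ‖e x‖ := by
    intro x
    have h := hk.norm_sum_multiplier_le hm hC0 hC (s := x.support.map (Function.Embedding.subtype _))
      (by simp; tauto) (Function.extend Subtype.val x 0)
    have h1 : ‖e x‖ = ‖e₀ x‖ := rfl
    rw [h1]
    simp only [e₀, f, Finsupp.linearCombination_apply, Finsupp.sum]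
    rw [Finset.sum_map, Finset.sum_map] at h
    simp only [Function.Embedding.subtype_apply, Subtype.val_injective.extend_apply] at h
    simpa only [smul_smul, mul_comm] using h
  have hdense : DenseRange e := by
    intro y
    rw [closure_subtype]
    have hy : (y : E) ∈ closure (LinearMap.range e₀ : Set E) := y.2
    convert hy using 2
    ext z
    constructor
    · rintro ⟨_, ⟨x, rfl⟩, rfl⟩
      exact ⟨x, rfl⟩
    · rintro ⟨x, rfl⟩
      exact ⟨e x, ⟨x, rfl⟩, rfl⟩
  have : CompleteSpace X := (Submodule.isClosed_topologicalClosure _).completeSpace_coe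
  let T := (f.extendOfNorm e).comp X.orthogonalProjectionOnto
  refine ⟨T, ContinuousLinearMap.opNorm_le_bound _ hC0 fun x => ?_, fun w hw => ?_⟩
  · refine (LinearMap.norm_extendOfNorm_apply_le hdense C hbound _).trans ?_
    gcongr
    exact Submodule.norm_orthogonalProjectionOnto_apply_le _ _
  · have h1 : e₀ (Finsupp.single ⟨w, hw⟩ 1) = k w := by simp [e₀]
    have h2 : X.orthogonalProjectionOnto (k w) = e (Finsupp.single ⟨w, hw⟩ 1) := by
      apply Subtype.ext
      rw [← h1]
      exact Submodule.orthogonalProjectionOnto_mem_subspace_eq_self (K := X) (e (Finsupp.single ⟨w, hw⟩ 1)) ▸ rfl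
    simp only [T, ContinuousLinearMap.comp_apply]
    rw [h2, LinearMap.extendOfNorm_eq hdense ⟨C, hbound⟩]
    simp [f]

end IsHardyKernel

/-- The space `L²(0, ∞)`. -/
abbrev L2Half : Type := Lp ℂ 2 (volume.restrict (Set.Ioi (0 : ℝ)))

lemma memLp_exp_neg_conj_mul {w : ℂ} (hw : 0 < w.re) :
    MemLp (fun ξ : ℝ => cexp (-conj w * ξ)) 2 (volume.restrict (Set.Ioi (0 : ℝ))) := by
  refine (memLp_two_iff_integrable_sq_norm (by fun_prop)).2 ?_
  have h : (fun ξ : ℝ => ‖cexp (-conj w * ξ)‖ ^ 2) = fun ξ : ℝ => Real.exp (-(2 * w.re) * ξ) := by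
    funext ξ
    rw [norm_exp, ← Real.exp_nat_mul]
    simp; ring
  rw [h]
  exact exp_neg_integrableOn_Ioi 0 (by positivity)

/-- The exponentials that reproduce the Laplace transform on `L²(0, ∞)`. -/
noncomputable def expKernel (w : ℂ) : L2Half :=
  if h : 0 < w.re then (memLp_exp_neg_conj_mul h).toLp else 0

lemma coeFn_expKernel {w : ℂ} (hw : 0 < w.re) :
    expKernel w =ᵐ[volume.restrict (Set.Ioi (0 : ℝ))] fun ξ : ℝ => cexp (-conj w * ξ) := by
  rw [expKernel, dif_pos hw]
  exact MemLp.coeFn_toLp _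

/-- The Laplace transform on `L²(0, ∞)`. -/
noncomputable def laplace (φ : L2Half) (w : ℂ) : ℂ := ⟪expKernel w, φ⟫_ℂ

lemma laplace_integrand_ae {w : ℂ} (hw : 0 < w.re) (φ : L2Half) :
    (fun ξ : ℝ => ⟪expKernel w ξ, φ ξ⟫_ℂ) =ᵐ[volume.restrict (Set.Ioi (0 : ℝ))]
      fun ξ : ℝ => cexp (-w * ξ) * φ ξ := by
  filter_upwards [coeFn_expKernel hw] with ξ hξ
  rw [hξ, RCLike.inner_apply, ← exp_conj, mul_comm]
  simp

lemma laplace_integrable {w : ℂ} (hw : 0 < w.re) (φ : L2Half) :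
    IntegrableOn (fun ξ : ℝ => cexp (-w * ξ) * φ ξ) (Set.Ioi 0) :=
  (L2.integrable_inner (𝕜 := ℂ) (expKernel w) φ).congr (laplace_integrand_ae hw φ)

lemma laplace_eq {w : ℂ} (hw : 0 < w.re) (φ : L2Half) :
    laplace φ w = ∫ ξ : ℝ in Set.Ioi 0, cexp (-w * ξ) * φ ξ := by
  rw [laplace, L2.inner_def]
  exact integral_congr_ae (laplace_integrand_ae hw φ)

lemma isHardyKernel_expKernel : IsHardyKernel expKernel := by
  intro w v hw hv
  change laplace (expKernel v) w = _
  rw [laplace_eq hw]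
  have h : (∫ ξ : ℝ in Set.Ioi 0, cexp (-w * ξ) * expKernel v ξ) =
      ∫ ξ : ℝ in Set.Ioi 0, cexp (-(w + conj v) * ξ) := by
    refine integral_congr_ae ?_
    filter_upwards [coeFn_expKernel hv] with ξ hξ
    rw [hξ, ← Complex.exp_add]
    ring_nf
  rw [h, integral_exp_mul_complex_Ioi (by simp; linarith)]
  rw [ofReal_zero, mul_zero, Complex.exp_zero, neg_div_neg_eq]

lemma laplace_add (φ ψ : L2Half) (w : ℂ) : laplace (φ + ψ) w = laplace φ w + laplace ψ w :=
  inner_add_right _ _ _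

lemma norm_laplace_le (φ : L2Half) (w : ℂ) : ‖laplace φ w‖ ≤ ‖expKernel w‖ * ‖φ‖ :=
  norm_inner_le_norm _ _

lemma differentiableAt_laplace {w : ℂ} (hw : 0 < w.re) (φ : L2Half) :
    DifferentiableAt ℂ (laplace φ) w := by
  set ε := w.re / 2 with hε
  have hεpos : 0 < ε := by positivity
  have hs : {z : ℂ | ε < z.re} ∈ 𝓝 w :=
    (isOpen_lt continuous_const continuous_re).mem_nhds (by simp [hε]; linarith)
  have hbd : IntegrableOn (fun ξ : ℝ => (2 / ε) * ‖cexp (-((ε / 2 : ℝ) : ℂ) * ξ) * φ ξ‖)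
      (Set.Ioi 0) :=
    (laplace_integrable (w := ((ε / 2 : ℝ) : ℂ)) (by simp; positivity) φ).norm.const_mul _
  have hφ : AEStronglyMeasurable φ (volume.restrict (Set.Ioi (0 : ℝ))) := Lp.aestronglyMeasurable φ
  have key := hasDerivAt_integral_of_dominated_loc_of_deriv_le (𝕜 := ℂ)
    (μ := volume.restrict (Set.Ioi (0 : ℝ))) (F := fun z (ξ : ℝ) => cexp (-z * ξ) * φ ξ)
    (F' := fun z (ξ : ℝ) => (cexp (-z * ξ) * (-(ξ : ℂ))) * φ ξ) (x₀ := w) hs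
    (Eventually.of_forall fun z => (Continuous.aestronglyMeasurable (by fun_prop)).mul hφ)
    (laplace_integrable hw φ)
    ((Continuous.aestronglyMeasurable (by fun_prop)).mul hφ)
    (bound := fun ξ : ℝ => (2 / ε) * ‖cexp (-((ε / 2 : ℝ) : ℂ) * ξ) * φ ξ‖)
    ?_ hbd ?_
  · refine (key.2.congr_of_eventuallyEq ?_).differentiableAt
    filter_upwards [hs] with z hz
    exact laplace_eq (hεpos.trans hz) φ
  · refine (ae_restrict_mem measurableSet_Ioi).mono fun ξ hξ z hz => ?_
    have hξ' : 0 < ξ := hξ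
    have hz' : ε < z.re := hz
    rw [norm_mul, norm_mul, norm_mul, ← mul_assoc]
    refine mul_le_mul_of_nonneg_right ?_ (norm_nonneg _)
    rw [norm_exp, norm_exp, norm_neg, norm_real, Real.norm_eq_abs, abs_of_pos hξ']
    have e1 : (-z * ξ : ℂ).re = -(z.re * ξ) := by simp
    have e2 : (-((ε / 2 : ℝ) : ℂ) * ξ).re = -(ε / 2 * ξ) := by simp
    rw [e1, e2]
    have h1 : ξ ≤ 2 / ε * Real.exp (ε / 2 * ξ) := by
      have := Real.add_one_le_exp (ε / 2 * ξ)
      have h3 : ε / 2 * ξ ≤ Real.exp (ε / 2 * ξ) := by linarith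
      calc ξ = 2 / ε * (ε / 2 * ξ) := by field_simp
        _ ≤ _ := by gcongr
    have h2 : Real.exp (-(z.re * ξ)) ≤ Real.exp (-(ε * ξ)) := by
      apply Real.exp_le_exp.2
      nlinarith
    calc Real.exp (-(z.re * ξ)) * ξ ≤ Real.exp (-(ε * ξ)) * (2 / ε * Real.exp (ε / 2 * ξ)) := by
          gcongr
      _ = 2 / ε * (Real.exp (-(ε * ξ)) * Real.exp (ε / 2 * ξ)) := by ring
      _ = 2 / ε * Real.exp (-(ε / 2 * ξ)) := by rw [← Real.exp_add]; ring_nf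
  · refine Eventually.of_forall fun ξ z _ => ?_
    have h : HasDerivAt (fun z : ℂ => -z * (ξ : ℂ)) (-(ξ : ℂ)) z := by
      simpa using (hasDerivAt_id z).neg.mul_const (ξ : ℂ)
    exact (h.cexp).mul_const _

lemma differentiableOn_laplace (φ : L2Half) : DifferentiableOn ℂ (laplace φ) {w | 0 < w.re} :=
  fun _ hw => (differentiableAt_laplace hw φ).differentiableWithinAt

lemma eLpNorm_two_sq {X : Type*} [MeasurableSpace X] (f : X → ℂ) (μ : Measure X) :
    eLpNorm f 2 μ ^ 2 = ∫⁻ x, ‖f x‖ₑ ^ 2 ∂μ := by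
  have h := eLpNorm_nnreal_pow_eq_lintegral (f := f) (μ := μ) (p := 2) two_ne_zero
  have h2 : ((2 : NNReal) : ℝ) = ((2 : ℕ) : ℝ) := by norm_num
  simp only [h2, ENNReal.rpow_natCast] at h
  simpa using h

lemma enorm_integral_sq_le {X : Type*} [MeasurableSpace X] {f : X → ℂ} {μ : Measure X}
    (hf : AEStronglyMeasurable f μ) :
    ‖∫ x, f x ∂μ‖ₑ ^ 2 ≤ μ Set.univ * ∫⁻ x, ‖f x‖ₑ ^ 2 ∂μ := by
  have h1 : ‖∫ x, f x ∂μ‖ₑ ≤ eLpNorm f 1 μ := by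
    rw [eLpNorm_one_eq_lintegral_enorm]; exact enorm_integral_le_lintegral_enorm f
  have h2 := h1.trans (eLpNorm_le_eLpNorm_mul_rpow_measure_univ (q := 2) one_le_two hf)
  calc ‖∫ x, f x ∂μ‖ₑ ^ 2
      ≤ (eLpNorm f 2 μ * μ Set.univ ^ (1 / (1 : ℝ≥0∞).toReal - 1 / (2 : ℝ≥0∞).toReal)) ^ 2 := by
        gcongr
    _ = _ := by
        rw [mul_pow, eLpNorm_two_sq, ← ENNReal.rpow_natCast (_ ^ _), ← ENNReal.rpow_mul, mul_comm]
        norm_num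

/-- The logarithmic grid `log ((N + k) / N)`. -/
noncomputable def logGrid (N k : ℕ) : ℝ := Real.log ((N + k : ℕ) / N)

/-- The first point of the logarithmic grid that is at least `η`. -/
noncomputable def logCeil (N : ℕ) (η : ℝ) : ℝ := Real.log (⌈N * Real.exp η⌉₊ / N)

lemma measurable_logCeil (N : ℕ) : Measurable (logCeil N) := by
  unfold logCeil
  have h1 : Measurable fun η : ℝ => ⌈N * Real.exp η⌉₊ :=
    Nat.measurable_ceil.comp (by fun_prop)
  have h2 : Measurable fun n : ℕ => Real.log (n / N) := measurable_of_countable _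
  exact h2.comp h1

lemma logCeil_le {N : ℕ} (hN : 0 < N) {η : ℝ} (hη : 0 ≤ η) : logCeil N η ≤ η + 1 / N := by
  have hN' : (0 : ℝ) < N := by exact_mod_cast hN
  have h1 : (⌈N * Real.exp η⌉₊ : ℝ) ≤ N * Real.exp η + 1 := (Nat.ceil_lt_add_one (by positivity)).le
  have h0 : (0 : ℝ) < ⌈N * Real.exp η⌉₊ := by
    exact_mod_cast Nat.ceil_pos.2 (by positivity)
  rw [logCeil, Real.log_le_iff_le_exp (by positivity), Real.exp_add, div_le_iff₀ hN']
  have h2 := Real.add_one_le_exp (1 / (N : ℝ))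
  have h3 := Real.one_le_exp hη
  have h4 : Real.exp η * (1 / N + 1) * N ≤ Real.exp η * Real.exp (1 / N) * N := by gcongr
  have h5 : Real.exp η * (1 / N + 1) * N = Real.exp η + N * Real.exp η := by field_simp
  linarith

lemma logGrid_zero {N : ℕ} (hN : 0 < N) : logGrid N 0 = 0 := by
  have hN' : (N : ℝ) ≠ 0 := by exact_mod_cast hN.ne'
  simp [logGrid, hN']

lemma monotone_logGrid {N : ℕ} (hN : 0 < N) : Monotone (logGrid N) := by
  have hN' : (0 : ℝ) < N := by exact_mod_cast hN
  intro a b hab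
  unfold logGrid
  gcongr

lemma logGrid_succ_sub {N : ℕ} (hN : 0 < N) (k : ℕ) :
    logGrid N (k + 1) - logGrid N k = Real.log (1 + 1 / (N + k : ℕ)) := by
  have hN' : (0 : ℝ) < N := by exact_mod_cast hN
  have h1 : (0 : ℝ) < (N + k : ℕ) := by positivity
  unfold logGrid
  rw [← Real.log_div (by positivity) (by positivity)]
  congr 1
  field_simp
  push_cast
  ring

lemma exp_logGrid {N : ℕ} (hN : 0 < N) (k : ℕ) : Real.exp (logGrid N k) = (N + k : ℕ) / N := by
  have hN' : (0 : ℝ) < N := by exact_mod_cast hN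
  have h1 : (0 : ℝ) < (N + k : ℕ) := by positivity
  rw [logGrid, Real.exp_log (by positivity)]

lemma ceil_eq_of_mem_Ioc {N : ℕ} (hN : 0 < N) {k : ℕ} {η : ℝ}
    (hη : η ∈ Set.Ioc (logGrid N k) (logGrid N (k + 1))) : ⌈N * Real.exp η⌉₊ = N + k + 1 := by
  have hN' : (0 : ℝ) < N := by exact_mod_cast hN
  have h1 := Real.exp_lt_exp.2 hη.1
  have h2 := Real.exp_le_exp.2 hη.2
  rw [exp_logGrid hN, div_lt_iff₀ hN'] at h1
  rw [exp_logGrid hN, le_div_iff₀ hN'] at h2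
  rw [Nat.ceil_eq_iff (by omega)]
  constructor
  · rw [Nat.add_sub_cancel]; linarith
  · rw [mul_comm]; exact_mod_cast h2

lemma logCeil_eq_of_mem_Ioc {N : ℕ} (hN : 0 < N) {k : ℕ} {η : ℝ}
    (hη : η ∈ Set.Ioc (logGrid N k) (logGrid N (k + 1))) : logCeil N η = logGrid N (k + 1) := by
  rw [logCeil, ceil_eq_of_mem_Ioc hN hη, logGrid, add_assoc]

lemma iUnion_Ioc_logGrid {N : ℕ} (hN : 0 < N) :
    ⋃ k, Set.Ioc (logGrid N k) (logGrid N (k + 1)) = Set.Ioi 0 := by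
  have hN' : (0 : ℝ) < N := by exact_mod_cast hN
  have h := iUnion_Ioc_map_succ_eq_Ioi (f := logGrid N) (fun a => monotone_logGrid hN bot_le) ?_
  · simpa [logGrid_zero hN] using h
  · rintro ⟨B, hB⟩
    obtain ⟨n, hn⟩ := exists_nat_gt (N * Real.exp B)
    have h1 := hB ⟨n, rfl⟩
    have h2 := Real.exp_le_exp.2 h1
    rw [exp_logGrid hN, div_le_iff₀ hN'] at h2
    push_cast at h2
    linarith

lemma pairwise_disjoint_Ioc_logGrid {N : ℕ} (hN : 0 < N) :
    Pairwise (Function.onFun Disjoint fun k => Set.Ioc (logGrid N k) (logGrid N (k + 1))) :=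
  (monotone_logGrid hN).pairwise_disjoint_on_Ioc_succ

lemma logGrid_nonneg {N : ℕ} (hN : 0 < N) (k : ℕ) : 0 ≤ logGrid N k := by
  rw [← logGrid_zero hN]; exact monotone_logGrid hN (Nat.zero_le k)

lemma Ioc_logGrid_subset {N : ℕ} (hN : 0 < N) (k : ℕ) :
    Set.Ioc (logGrid N k) (logGrid N (k + 1)) ⊆ Set.Ioi 0 :=
  fun _ hξ => (logGrid_nonneg hN k).trans_lt hξ.1

lemma L2Half.integrableOn_Ioc (φ : L2Half) {a : ℝ} (ha : 0 ≤ a) (b : ℝ) :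
    IntegrableOn φ (Set.Ioc a b) := by
  have h1 : MemLp φ 2 (volume.restrict (Set.Ioc a b)) :=
    (Lp.memLp φ).mono_measure (Measure.restrict_mono
      (fun ξ hξ => ha.trans_lt hξ.1) le_rfl)
  exact h1.integrable one_le_two

/-- The integral of `φ` from `η` to the next point of the logarithmic grid. -/
noncomputable def blockTail (N : ℕ) (φ : ℝ → ℂ) (η : ℝ) : ℂ :=
  ∫ ξ in Set.Ioc η (logCeil N η), φ ξ

lemma stronglyMeasurable_blockTail (N : ℕ) {φ : ℝ → ℂ} (hφ : StronglyMeasurable φ) :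
    StronglyMeasurable (blockTail N φ) := by
  have hS : MeasurableSet {p : ℝ × ℝ | p.1 < p.2 ∧ p.2 ≤ logCeil N p.1} :=
    (measurableSet_lt measurable_fst measurable_snd).inter
      (measurableSet_le measurable_snd ((measurable_logCeil N).comp measurable_fst))
  have h := ((hφ.comp_measurable measurable_snd).indicator hS).integral_prod_right'
    (ν := (volume : Measure ℝ))
  convert h using 2 with η
  rw [blockTail, ← integral_indicator measurableSet_Ioc]
  rfl

lemma lintegral_blockTail_le {N : ℕ} (hN : 0 < N) {φ : ℝ → ℂ} (hφ : StronglyMeasurable φ) :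
    ∫⁻ η in Set.Ioi 0, ‖blockTail N φ η‖ₑ ^ 2 ≤
      ENNReal.ofReal (1 / N) ^ 2 * ∫⁻ ξ in Set.Ioi 0, ‖φ ξ‖ₑ ^ 2 := by
  set δ : ℝ := 1 / N with hδ
  set S : Set (ℝ × ℝ) := {p : ℝ × ℝ | p.1 < p.2 ∧ p.2 ≤ p.1 + δ} with hS_def
  have hS : MeasurableSet S :=
    (measurableSet_lt measurable_fst measurable_snd).inter
      (measurableSet_le measurable_snd (by fun_prop))
  set F : ℝ → ℝ≥0∞ := fun ξ => ‖φ ξ‖ₑ ^ 2 with hF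
  have hFm : Measurable F := (hφ.enorm).pow_const 2
  have hpt : ∀ η ∈ Set.Ioi (0 : ℝ), ‖blockTail N φ η‖ₑ ^ 2 ≤
      ENNReal.ofReal δ * ∫⁻ ξ in Set.Ioi 0, S.indicator (fun p => F p.2) (η, ξ) := by
    intro η hη
    have hη' : (0 : ℝ) < η := hη
    refine (enorm_integral_sq_le hφ.aestronglyMeasurable).trans ?_
    have hle := logCeil_le hN hη'.le
    refine mul_le_mul' ?_ ?_
    · rw [Measure.restrict_apply_univ, Real.volume_Ioc]
      exact ENNReal.ofReal_le_ofReal (by linarith)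
    · rw [← lintegral_indicator measurableSet_Ioc, ← lintegral_indicator measurableSet_Ioi]
      refine lintegral_mono fun ξ => ?_
      by_cases hξ : ξ ∈ Set.Ioc η (logCeil N η)
      · have h1 : ξ ∈ Set.Ioi (0 : ℝ) := hη'.trans hξ.1
        have h2 : (η, ξ) ∈ S := ⟨hξ.1, hξ.2.trans hle⟩
        rw [Set.indicator_of_mem hξ, Set.indicator_of_mem h1, Set.indicator_of_mem h2]
      · rw [Set.indicator_of_notMem hξ]; exact zero_le
  calc ∫⁻ η in Set.Ioi 0, ‖blockTail N φ η‖ₑ ^ 2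
      ≤ ∫⁻ η in Set.Ioi 0, ENNReal.ofReal δ *
          ∫⁻ ξ in Set.Ioi 0, S.indicator (fun p => F p.2) (η, ξ) :=
        setLIntegral_mono' measurableSet_Ioi hpt
    _ = ENNReal.ofReal δ * ∫⁻ η in Set.Ioi 0,
          ∫⁻ ξ in Set.Ioi 0, S.indicator (fun p => F p.2) (η, ξ) :=
        lintegral_const_mul' _ _ ENNReal.ofReal_ne_top
    _ = ENNReal.ofReal δ * ∫⁻ ξ in Set.Ioi 0,
          ∫⁻ η in Set.Ioi 0, S.indicator (fun p => F p.2) (η, ξ) := by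
        rw [lintegral_lintegral_swap]
        exact ((hFm.comp measurable_snd).indicator hS).aemeasurable
    _ ≤ ENNReal.ofReal δ * ∫⁻ ξ in Set.Ioi 0, ENNReal.ofReal δ * F ξ := by
        gcongr with ξ
        calc ∫⁻ η in Set.Ioi 0, S.indicator (fun p => F p.2) (η, ξ)
            ≤ ∫⁻ η, S.indicator (fun p => F p.2) (η, ξ) := setLIntegral_le_lintegral _ _
          _ = ∫⁻ η, (Set.Ico (ξ - δ) ξ).indicator (fun _ => F ξ) η := by
              refine lintegral_congr fun η => ?_
              have hiff : (η, ξ) ∈ S ↔ η ∈ Set.Ico (ξ - δ) ξ := by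
                simp only [hS_def, Set.mem_ofPred_eq, Set.mem_Ico]
                constructor <;> rintro ⟨h1, h2⟩ <;> constructor <;> linarith
              by_cases hη : η ∈ Set.Ico (ξ - δ) ξ
              · rw [Set.indicator_of_mem hη, Set.indicator_of_mem (hiff.2 hη)]
              · rw [Set.indicator_of_notMem hη, Set.indicator_of_notMem (mt hiff.1 hη)]
          _ = ENNReal.ofReal δ * F ξ := by
              rw [lintegral_indicator_const measurableSet_Ico, Real.volume_Ico, mul_comm]
              congr 2; ring
    _ = _ := by rw [lintegral_const_mul' _ _ ENNReal.ofReal_ne_top, ← mul_assoc, sq]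

lemma eLpNorm_blockTail_le {N : ℕ} (hN : 0 < N) {φ : ℝ → ℂ} (hφ : StronglyMeasurable φ) :
    eLpNorm (blockTail N φ) 2 (volume.restrict (Set.Ioi 0)) ≤
      ENNReal.ofReal (1 / N) * eLpNorm φ 2 (volume.restrict (Set.Ioi 0)) := by
  have h := lintegral_blockTail_le hN hφ
  rw [← eLpNorm_two_sq, ← eLpNorm_two_sq, ← mul_pow] at h
  exact (ENNReal.pow_le_pow_left_iff two_ne_zero).1 h

lemma memLp_blockTail {N : ℕ} (hN : 0 < N) (φ : L2Half) :
    MemLp (blockTail N φ) 2 (volume.restrict (Set.Ioi 0)) :=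
  ⟨(stronglyMeasurable_blockTail N (Lp.stronglyMeasurable φ)).aestronglyMeasurable,
    (eLpNorm_blockTail_le hN (Lp.stronglyMeasurable φ)).trans_lt
      (ENNReal.mul_lt_top ENNReal.ofReal_lt_top (Lp.eLpNorm_lt_top φ))⟩

lemma blockTail_congr {N : ℕ} {φ ψ : ℝ → ℂ} (h : φ =ᵐ[volume.restrict (Set.Ioi 0)] ψ) {η : ℝ}
    (hη : 0 ≤ η) : blockTail N φ η = blockTail N ψ η :=
  integral_congr_ae (ae_restrict_of_ae_restrict_of_subset
    (fun _ hξ => hη.trans_lt hξ.1) h)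

/-- The operator `φ ↦ blockTail N φ` on `L²(0, ∞)`. -/
noncomputable def blockTailOp {N : ℕ} (hN : 0 < N) : L2Half →L[ℂ] L2Half :=
  LinearMap.mkContinuous
    { toFun := fun φ => (memLp_blockTail hN φ).toLp
      map_add' := by
        intro φ ψ
        rw [← MemLp.toLp_add]
        refine (MemLp.toLp_eq_toLp_iff _ _).2 ((ae_restrict_mem measurableSet_Ioi).mono fun η hη => ?_)
        have hη' : (0 : ℝ) ≤ η := le_of_lt hη
        rw [blockTail_congr (Lp.coeFn_add φ ψ) hη']
        exact integral_add (L2Half.integrableOn_Ioc φ hη' _) (L2Half.integrableOn_Ioc ψ hη' _)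
      map_smul' := by
        intro c φ
        rw [RingHom.id_apply, ← MemLp.toLp_const_smul]
        refine (MemLp.toLp_eq_toLp_iff _ _).2 ((ae_restrict_mem measurableSet_Ioi).mono fun η hη => ?_)
        have hη' : (0 : ℝ) ≤ η := le_of_lt hη
        rw [blockTail_congr (Lp.coeFn_smul c φ) hη']
        exact integral_smul c _ }
    (1 / N) (by
      intro φ
      change ‖(memLp_blockTail hN φ).toLp‖ ≤ _
      rw [Lp.norm_toLp, Lp.norm_def]
      have h := ENNReal.toReal_mono (ENNReal.mul_ne_top ENNReal.ofReal_ne_top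
        (Lp.eLpNorm_ne_top φ)) (eLpNorm_blockTail_le hN (Lp.stronglyMeasurable φ))
      rwa [ENNReal.toReal_mul, ENNReal.toReal_ofReal (by positivity)] at h)

lemma norm_blockTailOp_le {N : ℕ} (hN : 0 < N) : ‖blockTailOp hN‖ ≤ 1 / N :=
  LinearMap.mkContinuous_norm_le _ (by positivity) _

lemma coeFn_blockTailOp {N : ℕ} (hN : 0 < N) (φ : L2Half) :
    blockTailOp hN φ =ᵐ[volume.restrict (Set.Ioi 0)] blockTail N φ :=
  MemLp.coeFn_toLp (memLp_blockTail hN φ)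

lemma integral_Ioc_exp {a ξ : ℝ} (h : a ≤ ξ) (u : ℂ) :
    ∫ η in Set.Ioc a ξ, u * cexp (-u * η) = cexp (-u * a) - cexp (-u * ξ) := by
  rw [← intervalIntegral.integral_of_le h,
    intervalIntegral.integral_eq_sub_of_hasDerivAt (f := fun η : ℝ => -cexp (-u * η))]
  · ring
  · intro η _
    have h1 : HasDerivAt (fun η : ℝ => -u * (η : ℂ)) (-u) η := by
      simpa using (ofRealCLM.hasDerivAt (x := η)).const_mul (-u)
    exact h1.cexp.neg.congr_deriv (by ring)
  · exact Continuous.intervalIntegrable (by fun_prop) _ _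

lemma integral_exp_mul_tail {a b : ℝ} {φ : ℝ → ℂ} (hφ : IntegrableOn φ (Set.Ioc a b)) (u : ℂ) :
    ∫ η in Set.Ioc a b, u * cexp (-u * η) * ∫ ξ in Set.Ioc η b, φ ξ =
      ∫ ξ in Set.Ioc a b, (cexp (-u * a) - cexp (-u * ξ)) * φ ξ := by
  set μ := volume.restrict (Set.Ioc a b) with hμ
  set S : Set (ℝ × ℝ) := {p | p.1 < p.2} with hS_def
  have hS : MeasurableSet S := measurableSet_lt measurable_fst measurable_snd
  have hE : Integrable (fun η : ℝ => u * cexp (-u * η)) μ :=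
    (Continuous.integrableOn_Icc (by fun_prop)).mono_set Set.Ioc_subset_Icc_self
  have hint : Integrable (S.indicator fun p : ℝ × ℝ => u * cexp (-u * p.1) * φ p.2) (μ.prod μ) :=
    (hE.mul_prod hφ).indicator hS
  have h1 : ∀ η ∈ Set.Ioc a b, u * cexp (-u * η) * ∫ ξ in Set.Ioc η b, φ ξ =
      ∫ ξ, S.indicator (fun p : ℝ × ℝ => u * cexp (-u * p.1) * φ p.2) (η, ξ) ∂μ := by
    intro η hη
    rw [← integral_const_mul, hμ, ← integral_indicator measurableSet_Ioc,
      ← integral_indicator measurableSet_Ioc]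
    congr 1
    funext ξ
    simp only [Set.indicator_apply, hS_def, Set.mem_Ioc, Set.mem_ofPred_eq]
    by_cases h1 : η < ξ <;> by_cases h2 : ξ ≤ b <;> simp [h1, h2]
    intro h3
    exact absurd (hη.1.trans h1) (not_lt.2 h3)
  have h2 : ∀ ξ ∈ Set.Ioc a b, ∫ η, S.indicator (fun p : ℝ × ℝ => u * cexp (-u * p.1) * φ p.2)
      (η, ξ) ∂μ = (cexp (-u * a) - cexp (-u * ξ)) * φ ξ := by
    intro ξ hξ
    rw [← integral_Ioc_exp hξ.1.le u, ← integral_mul_const, hμ, integral_Ioc_eq_integral_Ioo (y := ξ),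
      ← integral_indicator measurableSet_Ioc, ← integral_indicator measurableSet_Ioo]
    congr 1
    funext η
    simp only [Set.indicator_apply, hS_def, Set.mem_Ioc, Set.mem_Ioo, Set.mem_ofPred_eq]
    by_cases h1 : η < ξ <;> by_cases h2 : a < η <;> simp [h1, h2]
    intro h3
    exact absurd (h1.le.trans hξ.2) (not_le.2 h3)
  rw [setIntegral_congr_fun measurableSet_Ioc h1, ← setIntegral_congr_fun measurableSet_Ioc h2]
  exact integral_integral_swap (f := fun η ξ => S.indicator
    (fun p : ℝ × ℝ => u * cexp (-u * p.1) * φ p.2) (η, ξ)) hint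

/-- The integrals of `φ` over the blocks of the logarithmic grid. -/
noncomputable def gridCoeff (N : ℕ) (φ : ℝ → ℂ) (k : ℕ) : ℂ :=
  ∫ ξ in Set.Ioc (logGrid N k) (logGrid N (k + 1)), φ ξ

/-- The exponential sum attached to the block integrals of `φ`. -/
noncomputable def gridTransform {N : ℕ} (hN : 0 < N) (φ : L2Half) (u : ℂ) : ℂ :=
  laplace φ u + u * laplace (blockTailOp hN φ) u

lemma hasSum_gridCoeff {N : ℕ} (hN : 0 < N) (φ : L2Half) {u : ℂ} (hu : 0 < u.re) :
    HasSum (fun k => cexp (-u * logGrid N k) * gridCoeff N φ k) (gridTransform hN φ u) := by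
  have hi1 := laplace_integrable hu φ
  have hi2 : IntegrableOn (fun ξ : ℝ => u * (cexp (-u * ξ) * blockTailOp hN φ ξ)) (Set.Ioi 0) :=
    (laplace_integrable hu (blockTailOp hN φ)).const_mul u
  have hsum := hasSum_integral_iUnion (μ := volume) (f := fun ξ : ℝ => cexp (-u * ξ) * φ ξ +
      u * (cexp (-u * ξ) * blockTailOp hN φ ξ))
    (s := fun k => Set.Ioc (logGrid N k) (logGrid N (k + 1)))
    (fun _ => measurableSet_Ioc) (pairwise_disjoint_Ioc_logGrid hN)
    (by rw [iUnion_Ioc_logGrid hN]; exact hi1.add hi2)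
  rw [iUnion_Ioc_logGrid hN, integral_add hi1 hi2, integral_const_mul, ← laplace_eq hu,
    ← laplace_eq hu] at hsum
  rw [gridTransform]
  convert! hsum using 2 with k
  have hsub := Ioc_logGrid_subset hN k
  have hφi : IntegrableOn φ (Set.Ioc (logGrid N k) (logGrid N (k + 1))) :=
    L2Half.integrableOn_Ioc φ (logGrid_nonneg hN k) _
  rw [integral_add (hi1.mono_set hsub) (hi2.mono_set hsub)]
  have h1 : ∫ ξ in Set.Ioc (logGrid N k) (logGrid N (k + 1)),
      u * (cexp (-u * ξ) * blockTailOp hN φ ξ) =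
      ∫ η in Set.Ioc (logGrid N k) (logGrid N (k + 1)), u * cexp (-u * η) *
        ∫ ξ in Set.Ioc η (logGrid N (k + 1)), φ ξ := by
    refine integral_congr_ae ?_
    filter_upwards [ae_restrict_of_ae_restrict_of_subset hsub (coeFn_blockTailOp hN φ),
      ae_restrict_mem measurableSet_Ioc] with ξ h1 h2
    rw [h1, blockTail, logCeil_eq_of_mem_Ioc hN h2, mul_assoc]
  rw [h1, integral_exp_mul_tail hφi u, ← integral_add (hi1.mono_set hsub), gridCoeff,
    ← integral_const_mul]
  · congr 1
    funext ξ
    ring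
  · have h3 : IntegrableOn (fun ξ : ℝ => cexp (-u * logGrid N k) * φ ξ - cexp (-u * ξ) * φ ξ)
        (Set.Ioc (logGrid N k) (logGrid N (k + 1))) :=
      (hφi.const_mul _).sub (hi1.mono_set hsub)
    simp only [sub_mul]
    exact h3

lemma norm_gridCoeff_sq_le {N : ℕ} (hN : 0 < N) (φ : L2Half) (k : ℕ) :
    ((N + k : ℕ) : ℝ) * ‖gridCoeff N φ k‖ ^ 2 ≤
      ∫ ξ in Set.Ioc (logGrid N k) (logGrid N (k + 1)), ‖φ ξ‖ ^ 2 := by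
  have hpos : (0 : ℝ) < (N + k : ℕ) := by positivity
  have hL2 : IntegrableOn (fun ξ => ‖φ ξ‖ ^ 2) (Set.Ioc (logGrid N k) (logGrid N (k + 1))) :=
    IntegrableOn.mono_set ((memLp_two_iff_integrable_sq_norm (Lp.aestronglyMeasurable φ)).1
      (Lp.memLp φ)) (Ioc_logGrid_subset hN k)
  have h := enorm_integral_sq_le (f := φ) (μ := volume.restrict
    (Set.Ioc (logGrid N k) (logGrid N (k + 1)))) (Lp.stronglyMeasurable φ).aestronglyMeasurable
  have h2 : ∫⁻ ξ in Set.Ioc (logGrid N k) (logGrid N (k + 1)), ‖φ ξ‖ₑ ^ 2 =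
      ENNReal.ofReal (∫ ξ in Set.Ioc (logGrid N k) (logGrid N (k + 1)), ‖φ ξ‖ ^ 2) := by
    rw [ofReal_integral_eq_lintegral_ofReal hL2 (Eventually.of_forall fun _ => by positivity)]
    refine lintegral_congr fun ξ => ?_
    rw [ENNReal.ofReal_pow (norm_nonneg _), ofReal_norm]
  have h0 : 0 ≤ ∫ ξ in Set.Ioc (logGrid N k) (logGrid N (k + 1)), ‖φ ξ‖ ^ 2 :=
    integral_nonneg fun _ => by positivity
  have hlog : logGrid N (k + 1) - logGrid N k ≤ 1 / (N + k : ℕ) := by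
    rw [logGrid_succ_sub hN]
    have := Real.log_le_sub_one_of_pos (x := 1 + 1 / ((N + k : ℕ) : ℝ)) (by positivity)
    linarith
  have hlog0 : 0 ≤ logGrid N (k + 1) - logGrid N k :=
    sub_nonneg.2 (monotone_logGrid hN (Nat.le_succ k))
  rw [Measure.restrict_apply_univ, Real.volume_Ioc, h2, ← ofReal_norm,
    ← ENNReal.ofReal_pow (norm_nonneg _), ← ENNReal.ofReal_mul hlog0,
    ENNReal.ofReal_le_ofReal_iff (by positivity)] at h
  calc ((N + k : ℕ) : ℝ) * ‖gridCoeff N φ k‖ ^ 2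
      ≤ (N + k : ℕ) * ((1 / (N + k : ℕ)) *
          ∫ ξ in Set.Ioc (logGrid N k) (logGrid N (k + 1)), ‖φ ξ‖ ^ 2) := by
        gcongr
        exact h.trans (by gcongr)
    _ = _ := by field_simp

lemma summable_gridCoeff {N : ℕ} (hN : 0 < N) (φ : L2Half) :
    Summable fun k => ((N + k : ℕ) : ℝ) * ‖gridCoeff N φ k‖ ^ 2 := by
  have hL2 : IntegrableOn (fun ξ => ‖φ ξ‖ ^ 2) (Set.Ioi 0) :=
    (memLp_two_iff_integrable_sq_norm (Lp.aestronglyMeasurable φ)).1 (Lp.memLp φ)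
  have h := hasSum_integral_iUnion (μ := volume) (f := fun ξ : ℝ => ‖φ ξ‖ ^ 2)
    (s := fun k => Set.Ioc (logGrid N k) (logGrid N (k + 1)))
    (fun _ => measurableSet_Ioc) (pairwise_disjoint_Ioc_logGrid hN)
    (by rwa [iUnion_Ioc_logGrid hN])
  exact Summable.of_nonneg_of_le (fun k => by positivity) (norm_gridCoeff_sq_le hN φ) h.summable

lemma exp_neg_mul_logGrid {N : ℕ} (hN : 0 < N) (k : ℕ) (u : ℂ) :
    cexp (-u * logGrid N k) = (N : ℂ) ^ u * ((N + k : ℕ) : ℂ) ^ (-u) := by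
  have hN' : (0 : ℝ) < N := by exact_mod_cast hN
  have h1 : (0 : ℝ) < (N + k : ℕ) := by positivity
  have hN0 : (N : ℂ) ≠ 0 := by exact_mod_cast hN.ne'
  have hk0 : ((N + k : ℕ) : ℂ) ≠ 0 := by exact_mod_cast (by omega : N + k ≠ 0)
  rw [cpow_def_of_ne_zero hN0, cpow_def_of_ne_zero hk0, ← Complex.exp_add, ← natCast_log, ← natCast_log,
    logGrid, Real.log_div h1.ne' hN'.ne']
  push_cast
  ring_nf

lemma sqrt_mul_cpow {n : ℕ} (hn : 0 < n) (s : ℂ) :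
    (Real.sqrt n : ℂ) / (n : ℂ) ^ s = (n : ℂ) ^ (-(s - 1 / 2)) := by
  have hn0 : (n : ℂ) ≠ 0 := by exact_mod_cast hn.ne'
  rw [Real.sqrt_eq_rpow, ofReal_cpow (Nat.cast_nonneg n), ofReal_natCast, ← cpow_sub _ _ hn0]
  push_cast
  ring_nf

lemma gridTransform_mem_dirichletHardy {N : ℕ} (hN : 0 < N) (φ : L2Half) :
    (fun s : ℂ => (N : ℂ) ^ (-(s - 1 / 2)) * gridTransform hN φ (s - 1 / 2)) ∈ DirichletHardy := by
  have hN0 : (N : ℂ) ≠ 0 := by exact_mod_cast hN.ne'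
  set a : ℕ → ℂ := Function.extend (fun k => N + k)
    (fun k => (Real.sqrt (N + k : ℕ) : ℂ) * gridCoeff N φ k) 0 with ha
  have hinj : Function.Injective fun k => N + k := fun _ _ h => by simpa using h
  have hak : ∀ k, a (N + k) = (Real.sqrt (N + k : ℕ) : ℂ) * gridCoeff N φ k :=
    fun k => hinj.extend_apply _ _ k
  have ha0 : ∀ n, n ∉ Set.range (fun k => N + k) → a n = 0 := fun n hn =>
    Function.extend_apply' _ _ _ (by simpa using hn)
  refine ⟨a, ?_, fun s hs => ?_⟩
  · have h1 : Summable fun n => ‖a n‖ ^ 2 := by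
      rw [← hinj.summable_iff (fun n hn => by simp [ha0 n hn])]
      refine (summable_gridCoeff hN φ).congr fun k => ?_
      rw [Function.comp_apply, hak, norm_mul, mul_pow, norm_real, Real.norm_eq_abs, sq_abs,
        Real.sq_sqrt (Nat.cast_nonneg _)]
    exact h1.comp_injective Nat.succ_injective
  · have hu : 0 < (s - 1 / 2).re := by
      have : (1 / 2 : ℂ).re = 1 / 2 := by norm_num
      rw [sub_re, this]; linarith
    have h1 := (hasSum_gridCoeff hN φ hu).mul_left ((N : ℂ) ^ (-(s - 1 / 2)))
    rw [LSeriesHasSum, ← hinj.hasSum_iff]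
    · convert! h1 using 2 with k
      have hpos : 0 < N + k := by omega
      rw [Function.comp_apply, LSeries.term_of_ne_zero hpos.ne', hak, exp_neg_mul_logGrid hN,
        mul_div_right_comm, sqrt_mul_cpow hpos, ← mul_assoc, ← mul_assoc, ← cpow_add _ _ hN0]
      simp
    · intro n hn
      simp [LSeries.term, ha0 n hn]

lemma exists_gridCoeff_eq {a : ℕ → ℂ} (ha : Summable fun n => ‖a (n + 1)‖ ^ 2) :
    ∃ φ : L2Half, ∀ k, (Real.sqrt (1 + k : ℕ) : ℂ) * gridCoeff 1 φ k = a (1 + k) := by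
  set len : ℕ → ℝ := fun k => logGrid 1 (k + 1) - logGrid 1 k with hlen
  set g : ℕ → ℂ := fun n => a (n - 1) / (Real.sqrt (n - 1 : ℕ) * len (n - 2)) with hg
  set φ : ℝ → ℂ := fun ξ => g ⌈((1 : ℕ) : ℝ) * Real.exp ξ⌉₊ with hφ
  have hlen_lb : ∀ k : ℕ, 1 / (2 * ((1 + k : ℕ) : ℝ)) ≤ len k := by
    intro k
    have hpos : (0 : ℝ) < (1 + k : ℕ) := by positivity
    have hone : (1 : ℝ) ≤ (1 + k : ℕ) := by exact_mod_cast (by omega : 1 ≤ 1 + k)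
    simp only [hlen]
    rw [logGrid_succ_sub one_pos]
    refine le_trans ?_ (Real.one_sub_inv_le_log_of_pos (by positivity))
    have : 1 - (1 + 1 / ((1 + k : ℕ) : ℝ))⁻¹ = 1 / ((1 + k : ℕ) + 1) := by
      field_simp
      ring
    rw [this]
    exact one_div_le_one_div_of_le (by positivity) (by linarith)
  have hlen_pos : ∀ k, 0 < len k := fun k => lt_of_lt_of_le (by positivity) (hlen_lb k)
  have hblock : ∀ k, ∀ ξ ∈ Set.Ioc (logGrid 1 k) (logGrid 1 (k + 1)), φ ξ = g (1 + k + 1) := by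
    intro k ξ hξ
    simp only [hφ]
    rw [ceil_eq_of_mem_Ioc one_pos hξ]
  have hgk : ∀ k, g (1 + k + 1) = a (1 + k) / (Real.sqrt (1 + k : ℕ) * len k) := by
    intro k
    simp only [hg]
    rw [Nat.add_sub_cancel, show 1 + k + 1 - 2 = k by omega]
  have hmeas : Measurable φ := by
    have h1 : Measurable fun ξ : ℝ => ⌈((1 : ℕ) : ℝ) * Real.exp ξ⌉₊ :=
      Nat.measurable_ceil.comp (by fun_prop)
    exact (measurable_of_countable g).comp h1
  have hvol : ∀ k, volume.real (Set.Ioc (logGrid 1 k) (logGrid 1 (k + 1))) = len k := by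
    intro k
    rw [Real.volume_real_Ioc_of_le (monotone_logGrid one_pos (Nat.le_succ k))]
  have hLp : MemLp φ 2 (volume.restrict (Set.Ioi 0)) := by
    rw [memLp_two_iff_integrable_sq_norm hmeas.aestronglyMeasurable]
    change IntegrableOn (fun ξ => ‖φ ξ‖ ^ 2) (Set.Ioi 0)
    rw [← iUnion_Ioc_logGrid one_pos]
    have hcongr : ∀ k, Set.EqOn (fun ξ => ‖φ ξ‖ ^ 2) (fun _ => ‖g (1 + k + 1)‖ ^ 2)
        (Set.Ioc (logGrid 1 k) (logGrid 1 (k + 1))) := fun k ξ hξ => by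
      simp only [hblock k ξ hξ]
    refine integrableOn_iUnion_of_summable_integral_norm (fun k => ?_) ?_
    · exact (integrableOn_const (by simp)).congr_fun (hcongr k).symm measurableSet_Ioc
    · have hi : ∀ k, ∫ ξ in Set.Ioc (logGrid 1 k) (logGrid 1 (k + 1)), ‖‖φ ξ‖ ^ 2‖ =
          len k * ‖g (1 + k + 1)‖ ^ 2 := by
        intro k
        rw [setIntegral_congr_fun measurableSet_Ioc (g := fun _ => ‖g (1 + k + 1)‖ ^ 2)
          (fun ξ hξ => by simp only [norm_pow, norm_norm, hblock k ξ hξ]), setIntegral_const, hvol,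
          smul_eq_mul]
      simp_rw [hi]
      refine Summable.of_nonneg_of_le (fun k => mul_nonneg (hlen_pos k).le (by positivity))
        (fun k => ?_) (ha.mul_left 2)
      have hpos : (0 : ℝ) < (1 + k : ℕ) := by positivity
      have hl := hlen_pos k
      rw [hgk, norm_div, norm_mul, norm_real, norm_real, Real.norm_eq_abs, Real.norm_eq_abs,
        div_pow, mul_pow, sq_abs, sq_abs, Real.sq_sqrt hpos.le, add_comm k 1]
      have h2 := hlen_lb k
      rw [div_le_iff₀ (by positivity)] at h2
      have h3 : len k * (‖a (1 + k)‖ ^ 2 / ((1 + k : ℕ) * len k ^ 2)) =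
          ‖a (1 + k)‖ ^ 2 / ((1 + k : ℕ) * len k) := by
        field_simp
      rw [h3, div_le_iff₀ (by positivity)]
      nlinarith [sq_nonneg ‖a (1 + k)‖]
  refine ⟨hLp.toLp, fun k => ?_⟩
  have hpos : (0 : ℝ) < (1 + k : ℕ) := by positivity
  have h1 : gridCoeff 1 hLp.toLp k = len k * g (1 + k + 1) := by
    rw [gridCoeff, integral_congr_ae (ae_restrict_of_ae_restrict_of_subset
      (Ioc_logGrid_subset one_pos k) hLp.coeFn_toLp), setIntegral_congr_fun measurableSet_Ioc
      (hblock k), setIntegral_const, hvol, real_smul]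
  have h2 : (len k : ℂ) ≠ 0 := by exact_mod_cast (hlen_pos k).ne'
  have h3 : (Real.sqrt (1 + k : ℕ) : ℂ) ≠ 0 := by exact_mod_cast (Real.sqrt_pos.2 hpos).ne'
  rw [h1, hgk]
  field_simp

lemma exists_gridTransform_eq {f : ℂ → ℂ} (hf : f ∈ DirichletHardy) :
    ∃ φ : L2Half, ∀ s : ℂ, 1 / 2 < s.re → f s = gridTransform one_pos φ (s - 1 / 2) := by
  obtain ⟨a, ha, hsum⟩ := hf
  obtain ⟨φ, hφ⟩ := exists_gridCoeff_eq ha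
  refine ⟨φ, fun s hs => ?_⟩
  have hu : 0 < (s - 1 / 2).re := by
    have : (1 / 2 : ℂ).re = 1 / 2 := by norm_num
    rw [sub_re, this]; linarith
  refine HasSum.unique ?_ (hasSum_gridCoeff one_pos φ hu)
  have hinj : Function.Injective fun k => 1 + k := fun _ _ h => by simpa using h
  have h1 := hsum s hs
  rw [LSeriesHasSum, ← hinj.hasSum_iff] at h1
  · convert! h1 using 2 with k
    have hpos : 0 < 1 + k := by omega
    rw [Function.comp_apply, LSeries.term_of_ne_zero hpos.ne', exp_neg_mul_logGrid one_pos,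
      ← hφ, mul_div_right_comm, sqrt_mul_cpow hpos]
    simp
  · intro n hn
    have : n = 0 := by
      by_contra h0
      exact hn ⟨n - 1, by simp; omega⟩
    simp [this]

/-- The Blaschke factor of the right half-plane with zero `α`. -/
noncomputable def blaschkeFactor (α u : ℂ) : ℂ := (u - α) / (u + conj α)

lemma blaschkeFactor_eq {α u : ℂ} (hα : 0 < α.re) (hu : 0 < u.re) :
    blaschkeFactor α u = 1 + -(2 * α.re : ℝ) / (u + conj α) := by
  have h := add_conj_ne_zero hu hα
  have h2 : ((2 * α.re : ℝ) : ℂ) = α + conj α := (add_conj α).symm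
  rw [blaschkeFactor, h2]
  field_simp
  ring

lemma one_sub_norm_blaschkeFactor_sq {α u : ℂ} (hα : 0 < α.re) (hu : 0 < u.re) :
    1 - ‖blaschkeFactor α u‖ ^ 2 = 4 * α.re * u.re / ‖u + conj α‖ ^ 2 := by
  have h := norm_pos_iff.2 (add_conj_ne_zero hu hα)
  rw [blaschkeFactor, norm_div, div_pow, eq_div_iff (by positivity), sub_mul,
    div_mul_cancel₀ _ (by positivity), one_mul, ← normSq_eq_norm_sq, ← normSq_eq_norm_sq,
    normSq_apply, normSq_apply]
  simp
  ring

lemma norm_blaschkeFactor_le_one {α u : ℂ} (hα : 0 < α.re) (hu : 0 < u.re) :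
    ‖blaschkeFactor α u‖ ≤ 1 := by
  have h := one_sub_norm_blaschkeFactor_sq hα hu
  have h2 : 0 ≤ 4 * α.re * u.re / ‖u + conj α‖ ^ 2 := by positivity
  refine le_of_sq_le_sq ?_ zero_le_one
  linarith

lemma differentiableOn_blaschkeFactor {α : ℂ} (hα : 0 < α.re) :
    DifferentiableOn ℂ (blaschkeFactor α) {u | 0 < u.re} := by
  unfold blaschkeFactor
  exact DifferentiableOn.div (by fun_prop) (by fun_prop) fun u hu => add_conj_ne_zero hu hα

lemma norm_one_sub_blaschkeFactor {α u : ℂ} (hα : 0 < α.re) (hu : 0 < u.re) :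
    ‖1 - blaschkeFactor α u‖ = 2 * α.re / ‖u + conj α‖ := by
  rw [blaschkeFactor_eq hα hu, sub_add_cancel_left, norm_neg, norm_div, norm_neg, norm_real,
    Real.norm_of_nonneg (by positivity)]

lemma norm_one_sub_blaschkeFactor_le {α u : ℂ} (hα : 0 < α.re) (hu : 0 < u.re) :
    ‖1 - blaschkeFactor α u‖ ≤ 2 * α.re / u.re := by
  rw [norm_one_sub_blaschkeFactor hα hu]
  have h1 : u.re ≤ ‖u + conj α‖ := by
    refine le_trans ?_ (re_le_norm _)
    simp
    exact hα.le
  gcongr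

lemma norm_one_sub_prod_le {ι : Type*} (s : Finset ι) {b : ι → ℂ} (hb : ∀ i ∈ s, ‖b i‖ ≤ 1) :
    ‖1 - ∏ i ∈ s, b i‖ ≤ ∑ i ∈ s, ‖1 - b i‖ := by
  classical
  induction s using Finset.induction_on with
  | empty => simp
  | insert i s hi IH =>
    rw [prod_insert hi, sum_insert hi]
    have h1 : 1 - b i * ∏ j ∈ s, b j = (1 - b i) + b i * (1 - ∏ j ∈ s, b j) := by ring
    rw [h1]
    refine (norm_add_le _ _).trans ?_
    rw [norm_mul]
    have h2 := IH fun j hj => hb j (mem_insert_of_mem hj)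
    have h3 := hb i (mem_insert_self i s)
    have h4 : ‖b i‖ * ‖1 - ∏ j ∈ s, b j‖ ≤ 1 * ∑ j ∈ s, ‖1 - b j‖ := by gcongr
    linarith

/-- The Blaschke product of the right half-plane with zeros `α`. -/
noncomputable def blaschkeProd {ι : Type*} (α : ι → ℂ) (u : ℂ) : ℂ := ∏' i, blaschkeFactor (α i) u

section BlaschkeProd

variable {ι : Type*} {α : ι → ℂ}

lemma summable_one_sub_blaschkeFactor (hα : ∀ i, 0 < (α i).re) (hsum : Summable fun i => (α i).re)
    {u : ℂ} (hu : 0 < u.re) : Summable fun i => ‖1 - blaschkeFactor (α i) u‖ :=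
  Summable.of_nonneg_of_le (fun _ => norm_nonneg _)
    (fun i => norm_one_sub_blaschkeFactor_le (hα i) hu) ((hsum.mul_left 2).div_const _)

lemma multipliable_blaschkeFactor (hα : ∀ i, 0 < (α i).re) (hsum : Summable fun i => (α i).re)
    {u : ℂ} (hu : 0 < u.re) : Multipliable fun i => blaschkeFactor (α i) u := by
  have h := multipliable_one_add_of_summable (f := fun i => blaschkeFactor (α i) u - 1)
    (by simpa only [norm_sub_rev] using summable_one_sub_blaschkeFactor hα hsum hu)
  simpa using h

lemma differentiableOn_blaschkeProd (hα : ∀ i, 0 < (α i).re)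
    (hsum : Summable fun i => (α i).re) :
    DifferentiableOn ℂ (blaschkeProd α) {u | 0 < u.re} := by
  intro u hu
  have hu' : 0 < u.re := hu
  set K : Set ℂ := {z | u.re / 2 < z.re} with hK
  have hKo : IsOpen K := isOpen_lt continuous_const continuous_re
  have hKpos : ∀ z ∈ K, 0 < z.re := fun z hz => (half_pos hu').trans hz
  have hd : ∀ i, DifferentiableOn ℂ (blaschkeFactor (α i)) K := fun i =>
    (differentiableOn_blaschkeFactor (hα i)).mono hKpos
  have h := Summable.hasProdLocallyUniformlyOn_one_add
    (f := fun i z => blaschkeFactor (α i) z - 1) hKo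
    (u := fun i => 2 * (α i).re / (u.re / 2)) ((hsum.mul_left 2).div_const _)
    (Eventually.of_forall fun i z hz => ?_) (fun i => ((hd i).sub_const 1).continuousOn)
  · simp only [add_sub_cancel] at h
    have h2 : DifferentiableOn ℂ (blaschkeProd α) K := by
      refine h.differentiableOn (Eventually.of_forall fun s => ?_) hKo
      exact DifferentiableOn.fun_finsetProd fun i _ => hd i
    refine (h2.differentiableAt (hKo.mem_nhds ?_)).differentiableWithinAt
    change u.re / 2 < u.re
    linarith
  · rw [norm_sub_rev]
    refine (norm_one_sub_blaschkeFactor_le (hα i) (hKpos z hz)).trans ?_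
    have h1 : u.re / 2 < z.re := hz
    have h2 := hα i
    gcongr

lemma norm_blaschkeProd_le_one (hα : ∀ i, 0 < (α i).re) (hsum : Summable fun i => (α i).re)
    {u : ℂ} (hu : 0 < u.re) : ‖blaschkeProd α u‖ ≤ 1 := by
  refine le_of_tendsto (multipliable_blaschkeFactor hα hsum hu).hasProd.norm
    (Eventually.of_forall fun s => ?_)
  exact prod_le_one (fun _ _ => norm_nonneg _) fun i _ => norm_blaschkeFactor_le_one (hα i) hu

lemma norm_one_sub_blaschkeProd_le (hα : ∀ i, 0 < (α i).re) (hsum : Summable fun i => (α i).re)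
    {u : ℂ} (hu : 0 < u.re) : ‖1 - blaschkeProd α u‖ ≤ ∑' i, ‖1 - blaschkeFactor (α i) u‖ := by
  refine le_of_tendsto ((multipliable_blaschkeFactor hα hsum hu).hasProd.const_sub 1).norm
    (Eventually.of_forall fun s => ?_)
  refine (norm_one_sub_prod_le s fun i _ => norm_blaschkeFactor_le_one (hα i) hu).trans ?_
  exact (summable_one_sub_blaschkeFactor hα hsum hu).sum_le_tsum s fun _ _ => norm_nonneg _

lemma norm_mul_one_sub_blaschkeProd_le (hα : ∀ i, 0 < (α i).re)
    (hsum : Summable fun i => (α i).re) {R : ℝ} (hR : 0 < R) (hαR : ∀ i, ‖α i‖ ≤ R) {u : ℂ}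
    (hu : 0 < u.re) : ‖u * (1 - blaschkeProd α u)‖ ≤ 4 * (∑' i, (α i).re) + 4 * R := by
  have hpos : 0 ≤ ∑' i, (α i).re := tsum_nonneg fun i => (hα i).le
  rw [norm_mul]
  rcases le_total (2 * R) ‖u‖ with h | h
  · have hu0 : 0 < ‖u‖ := by linarith
    have h1 : ∑' i, ‖1 - blaschkeFactor (α i) u‖ ≤ ∑' i, 4 * (α i).re / ‖u‖ := by
      refine (summable_one_sub_blaschkeFactor hα hsum hu).tsum_le_tsum (fun i => ?_)
        ((hsum.mul_left 4).div_const _)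
      rw [norm_one_sub_blaschkeFactor (hα i) hu]
      have h2 : ‖u‖ / 2 ≤ ‖u + conj (α i)‖ := by
        have h3 := norm_sub_le_norm_add u (conj (α i))
        rw [RCLike.norm_conj] at h3
        linarith [hαR i]
      have h4 := hα i
      calc 2 * (α i).re / ‖u + conj (α i)‖ ≤ 2 * (α i).re / (‖u‖ / 2) := by gcongr
        _ = 4 * (α i).re / ‖u‖ := by field_simp; norm_num
    rw [tsum_div_const, tsum_mul_left] at h1
    calc ‖u‖ * ‖1 - blaschkeProd α u‖ ≤ ‖u‖ * (4 * (∑' i, (α i).re) / ‖u‖) := by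
          gcongr
          exact (norm_one_sub_blaschkeProd_le hα hsum hu).trans h1
      _ = 4 * (∑' i, (α i).re) := by field_simp
      _ ≤ _ := by linarith
  · have h1 : ‖1 - blaschkeProd α u‖ ≤ 2 := by
      refine (norm_sub_le _ _).trans ?_
      have := norm_blaschkeProd_le_one hα hsum hu
      rw [norm_one]; linarith
    nlinarith [norm_nonneg u, norm_nonneg (1 - blaschkeProd α u)]

lemma card_le_analyticOrderAt_blaschkeProd (hα : ∀ i, 0 < (α i).re)
    (hsum : Summable fun i => (α i).re) {z : ℂ} (hz : 0 < z.re) {J : Finset ι}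
    (hJ : ∀ i ∈ J, α i = z) : (#J : ℕ∞) ≤ analyticOrderAt (blaschkeProd α) z := by
  have hopen : IsOpen {u : ℂ | 0 < u.re} := isOpen_lt continuous_const continuous_re
  have hnhds : {u : ℂ | 0 < u.re} ∈ 𝓝 z := hopen.mem_nhds hz
  set β : ↥((J : Set ι)ᶜ) → ℂ := fun i => α i with hβ
  have hβpos : ∀ i, 0 < (β i).re := fun i => hα i
  have hβsum : Summable fun i => (β i).re := hsum.subtype _
  have hBan : AnalyticAt ℂ (blaschkeProd α) z :=
    (differentiableOn_blaschkeProd hα hsum).analyticAt hnhds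
  rw [natCast_le_analyticOrderAt hBan]
  refine ⟨fun u => (1 / (u + conj z)) ^ #J * blaschkeProd β u, ?_, ?_⟩
  · have h1 : AnalyticAt ℂ (fun u => 1 / (u + conj z)) z :=
      AnalyticAt.div analyticAt_const (by fun_prop) (add_conj_ne_zero hz hz)
    refine (h1.pow _).mul ?_
    exact (differentiableOn_blaschkeProd hβpos hβsum).analyticAt hnhds
  · filter_upwards [hnhds] with u hu
    have h1 : HasProd (fun i : ↥((J : Set ι)ᶜ) => blaschkeFactor (α i) u) (blaschkeProd β u) :=
      (multipliable_blaschkeFactor hβpos hβsum hu).hasProd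
    have h2 : HasProd (fun i : ↥(J : Set ι) => blaschkeFactor (α i) u)
        (∏ i ∈ J, blaschkeFactor (α i) u) :=
      J.hasProd fun i => blaschkeFactor (α i) u
    have h3 := HasProd.mul_compl (f := fun i => blaschkeFactor (α i) u) (s := (J : Set ι)) h2 h1
    rw [blaschkeProd, h3.tprod_eq,
      prod_congr rfl fun i hi => by rw [hJ i hi], prod_const, blaschkeFactor, div_eq_mul_one_div,
      mul_pow, smul_eq_mul, mul_assoc]

end BlaschkeProd

lemma analyticAt_blaschkeFactor {α z : ℂ} (hα : 0 < α.re) (hz : 0 < z.re) :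
    AnalyticAt ℂ (blaschkeFactor α) z :=
  (differentiableOn_blaschkeFactor hα).analyticAt
    ((isOpen_lt continuous_const continuous_re).mem_nhds hz)

lemma analyticOrderAt_blaschkeFactor {α z : ℂ} (hα : 0 < α.re) (hz : 0 < z.re) :
    analyticOrderAt (blaschkeFactor α) z = if α = z then 1 else 0 := by
  split_ifs with h
  · subst h
    have h1 : blaschkeFactor α = (fun u => u - α) * fun u => 1 / (u + conj α) := by
      funext u; rw [blaschkeFactor, Pi.mul_apply, mul_one_div]
    have hne := add_conj_ne_zero hα hα
    have h2 : AnalyticAt ℂ (fun u => 1 / (u + conj α)) α :=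
      AnalyticAt.div analyticAt_const (by fun_prop) hne
    rw [h1, analyticOrderAt_mul (by fun_prop) h2, analyticOrderAt_id_sub_const_self,
      h2.analyticOrderAt_eq_zero.2 (by simpa using hne), add_zero]
  · rw [(analyticAt_blaschkeFactor hα hz).analyticOrderAt_eq_zero]
    exact div_ne_zero (sub_ne_zero.2 (Ne.symm h)) (add_conj_ne_zero hz hα)

lemma analyticOrderAt_prod_blaschkeFactor {ι : Type*} [DecidableEq ι] {α : ι → ℂ}
    (hα : ∀ i, 0 < (α i).re) {z : ℂ} (hz : 0 < z.re) (J : Finset ι) :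
    AnalyticAt ℂ (fun u => ∏ i ∈ J, blaschkeFactor (α i) u) z ∧
    analyticOrderAt (fun u => ∏ i ∈ J, blaschkeFactor (α i) u) z = #{i ∈ J | α i = z} := by
  induction J using Finset.induction_on with
  | empty =>
    simp only [prod_empty, filter_empty, card_empty, Nat.cast_zero]
    exact ⟨analyticAt_const, analyticAt_const.analyticOrderAt_eq_zero.2 one_ne_zero⟩
  | insert i J hi IH =>
    have h1 : (fun u => ∏ j ∈ insert i J, blaschkeFactor (α j) u) =
        blaschkeFactor (α i) * fun u => ∏ j ∈ J, blaschkeFactor (α j) u := by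
      funext u; rw [prod_insert hi, Pi.mul_apply]
    rw [h1]
    refine ⟨(analyticAt_blaschkeFactor (hα i) hz).mul IH.1, ?_⟩
    rw [analyticOrderAt_mul (analyticAt_blaschkeFactor (hα i) hz) IH.1, IH.2,
      analyticOrderAt_blaschkeFactor (hα i) hz, filter_insert]
    split_ifs with h
    · rw [card_insert_of_notMem (by simp [hi])]
      push_cast
      ring
    · simp

lemma halfPlane_mem_nhds {z : ℂ} (hz : 0 < z.re) : {u : ℂ | 0 < u.re} ∈ 𝓝 z :=
  (isOpen_lt continuous_const continuous_re).mem_nhds hz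

lemma exists_laplace_mul {m : ℂ → ℂ} (hm : DifferentiableOn ℂ m {w | 0 < w.re}) {C : ℝ}
    (hC0 : 0 ≤ C) (hC : ∀ w : ℂ, 0 < w.re → ‖m w‖ ≤ C) :
    ∃ M : L2Half →L[ℂ] L2Half, ‖M‖ ≤ C ∧
      ∀ φ, ∀ w : ℂ, 0 < w.re → laplace (M φ) w = m w * laplace φ w := by
  obtain ⟨T, hT, hTk⟩ := isHardyKernel_expKernel.exists_multiplier hm hC0 hC
  refine ⟨ContinuousLinearMap.adjoint T, by rwa [LinearIsometryEquiv.norm_map], fun φ w hw => ?_⟩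
  rw [laplace, ContinuousLinearMap.adjoint_inner_right, hTk w hw, inner_smul_left, conj_conj,
    laplace]

lemma exists_laplace_eq_blaschkeFactor_mul {α : ℂ} (hα : 0 < α.re) {ψ : L2Half}
    (hψ : laplace ψ α = 0) :
    ∃ ψ' : L2Half, ‖ψ'‖ ≤ ‖ψ‖ ∧
      ∀ u : ℂ, 0 < u.re → laplace ψ u = blaschkeFactor α u * laplace ψ' u := by
  obtain ⟨T, hT, hTk⟩ := isHardyKernel_expKernel.exists_multiplier
    (differentiableOn_blaschkeFactor hα) zero_le_one fun w hw => norm_blaschkeFactor_le_one hα hw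
  set X := (Submodule.span ℂ (expKernel '' {w | 0 < w.re})).topologicalClosure with hX
  have : CompleteSpace X := (Submodule.isClosed_topologicalClosure _).completeSpace_coe
  have hkX : ∀ w : ℂ, 0 < w.re → expKernel w ∈ X := fun w hw =>
    Submodule.le_topologicalClosure _ (Submodule.subset_span ⟨w, hw, rfl⟩)
  set ψ₀ : L2Half := (X.orthogonalProjectionOnto ψ : L2Half) with hψ₀
  have hproj : ∀ w : ℂ, 0 < w.re → laplace ψ₀ w = laplace ψ w := by
    intro w hw
    have h := Submodule.inner_orthogonalProjectionOnto_eq_of_mem_left (K := X) ⟨_, hkX w hw⟩ ψ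
    exact h
  refine ⟨T ψ₀, ?_, fun u hu => ?_⟩
  · refine (T.le_opNorm _).trans ?_
    have h1 : ‖ψ₀‖ ≤ ‖ψ‖ := X.norm_orthogonalProjectionOnto_apply_le ψ
    calc ‖T‖ * ‖ψ₀‖ ≤ 1 * ‖ψ‖ := by gcongr
      _ = ‖ψ‖ := one_mul _
  · set c : ℂ := (2 * α.re : ℝ) / (u + conj α) with hc
    set v : L2Half := ContinuousLinearMap.adjoint T (T (expKernel u)) - expKernel u +
      conj c • expKernel α with hv
    have hvk : ∀ φ : L2Half, ⟪v, φ⟫_ℂ = ⟪T (expKernel u), T φ⟫_ℂ - laplace φ u +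
        c * laplace φ α := by
      intro φ
      rw [hv, inner_add_left, inner_sub_left, ContinuousLinearMap.adjoint_inner_left,
        inner_smul_left, conj_conj, laplace, laplace]
    have hle : X ≤ (ℂ ∙ v)ᗮ := by
      refine Submodule.topologicalClosure_minimal _ (Submodule.span_le.2 ?_)
        (Submodule.isClosed_orthogonal _)
      rintro _ ⟨w, hw, rfl⟩
      have hw' : 0 < w.re := hw
      rw [SetLike.mem_coe, Submodule.mem_orthogonal_singleton_iff_inner_right, hvk, hTk u hu,
        hTk w hw, laplace, laplace, inner_smul_left, inner_smul_right,
        isHardyKernel_expKernel u w hu hw, isHardyKernel_expKernel α w hα hw, conj_conj,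
        blaschkeFactor, blaschkeFactor, map_div₀, map_sub, map_add, conj_conj, hc]
      have h1 := add_conj_ne_zero hu hα
      have h2 := add_conj_ne_zero hu hw'
      have h3 := add_conj_ne_zero hα hw'
      have h4 : conj w + α ≠ 0 := by rwa [add_comm]
      have h5 : ((2 * α.re : ℝ) : ℂ) = α + conj α := (add_conj α).symm
      rw [h5]
      field_simp
      ring
    have h0 := Submodule.mem_orthogonal_singleton_iff_inner_right.1
      (hle (X.orthogonalProjectionOnto ψ).2)
    rw [hvk] at h0
    change ⟪T (expKernel u), T ψ₀⟫_ℂ - laplace ψ₀ u + c * laplace ψ₀ α = 0 at h0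
    rw [hproj α hα, hψ, mul_zero, add_zero, hTk u hu, inner_smul_left, conj_conj, hproj u hu,
      sub_eq_zero] at h0
    exact h0.symm

section Necessity

variable {ι : Type*} {α : ι → ℂ}

lemma exists_laplace_eq_prod_blaschkeFactor_mul (hα : ∀ i, 0 < (α i).re) {θ : L2Half}
    (hθ : ∀ z ∈ Set.range α, {j | α j = z}.encard ≤ analyticOrderAt (laplace θ) z)
    (J : Finset ι) : ∃ ψ : L2Half, ‖ψ‖ ≤ ‖θ‖ ∧
      ∀ u : ℂ, 0 < u.re → laplace θ u = (∏ i ∈ J, blaschkeFactor (α i) u) * laplace ψ u := by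
  classical
  induction J using Finset.induction_on with
  | empty => exact ⟨θ, le_rfl, fun u _ => by simp⟩
  | insert i J hi IH =>
    obtain ⟨ψ, hψ, hfac⟩ := IH
    have han : AnalyticAt ℂ (laplace ψ) (α i) :=
      (differentiableOn_laplace ψ).analyticAt (halfPlane_mem_nhds (hα i))
    obtain ⟨hPan, hPord⟩ := analyticOrderAt_prod_blaschkeFactor hα (hα i) J
    have h1 : analyticOrderAt (laplace θ) (α i) =
        #{j ∈ J | α j = α i} + analyticOrderAt (laplace ψ) (α i) := by
      rw [← hPord, ← analyticOrderAt_mul hPan han]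
      refine analyticOrderAt_congr ?_
      filter_upwards [halfPlane_mem_nhds (hα i)] with u hu using hfac u hu
    have h2 : ((#{j ∈ J | α j = α i} + 1 : ℕ) : ℕ∞) ≤ {j | α j = α i}.encard := by
      have h3 : (insert i {j ∈ J | α j = α i} : Finset ι).card = #{j ∈ J | α j = α i} + 1 :=
        card_insert_of_notMem (by simp [hi])
      rw [← h3, ← Set.encard_coe_eq_coe_finsetCard]
      refine Set.encard_le_encard fun j hj => ?_
      rcases mem_insert.1 (mem_coe.1 hj) with rfl | h
      · rfl
      · exact (mem_filter.1 h).2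
    have h3 := h2.trans (hθ _ ⟨i, rfl⟩)
    rw [h1, Nat.cast_add, ENat.add_le_add_iff_left (ENat.natCast_ne_top _), Nat.cast_one,
      Order.one_le_iff_ne_zero, han.analyticOrderAt_ne_zero] at h3
    obtain ⟨ψ', hψ', hfac'⟩ := exists_laplace_eq_blaschkeFactor_mul (hα i) h3
    refine ⟨ψ', hψ'.trans hψ, fun u hu => ?_⟩
    rw [hfac u hu, hfac' u hu, prod_insert hi]
    ring

lemma summable_re_of_laplace_zeros (hα : ∀ i, 0 < (α i).re) {R : ℝ} (hR : ∀ i, ‖α i‖ ≤ R)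
    {θ : L2Half}
    (hθ : ∀ z ∈ Set.range α, {j | α j = z}.encard ≤ analyticOrderAt (laplace θ) z)
    {u : ℂ} (hu : 0 < u.re) (hne : laplace θ u ≠ 0) : Summable fun i => (α i).re := by
  set A := ‖expKernel u‖ * ‖θ‖ with hA
  have hpos : 0 < ‖laplace θ u‖ := norm_pos_iff.2 hne
  have hApos : 0 < A := hpos.trans_le (norm_laplace_le θ u)
  set c := ‖laplace θ u‖ / A with hc
  have hcpos : 0 < c := by positivity
  rcases isEmpty_or_nonempty ι with h | ⟨⟨i₀⟩⟩
  · exact summable_empty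
  have hR0 : 0 ≤ R := (norm_nonneg _).trans (hR i₀)
  set K := 4 * u.re / (‖u‖ + R) ^ 2 with hK
  have hu0 : 0 < ‖u‖ := hu.trans_le (re_le_norm u)
  have hKpos : 0 < K := by positivity
  refine summable_of_sum_le (c := -Real.log (c ^ 2) / K) (fun i => (hα i).le) fun J => ?_
  obtain ⟨ψ, hψ, hfac⟩ := exists_laplace_eq_prod_blaschkeFactor_mul hα hθ J
  have h1 : c ≤ ‖∏ i ∈ J, blaschkeFactor (α i) u‖ := by
    rw [hc, div_le_iff₀ hApos, hfac u hu, norm_mul]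
    gcongr
    refine (norm_laplace_le ψ u).trans ?_
    rw [hA]
    gcongr
  have h2 : c ^ 2 ≤ Real.exp (-(K * ∑ i ∈ J, (α i).re)) := by
    calc c ^ 2 ≤ ‖∏ i ∈ J, blaschkeFactor (α i) u‖ ^ 2 := by gcongr
      _ = ∏ i ∈ J, ‖blaschkeFactor (α i) u‖ ^ 2 := by rw [norm_prod, prod_pow]
      _ ≤ ∏ i ∈ J, Real.exp (-(K * (α i).re)) := by
          refine prod_le_prod (fun _ _ => by positivity) fun i _ => ?_
          have h3 := one_sub_norm_blaschkeFactor_sq (hα i) hu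
          have h4 := norm_pos_iff.2 (add_conj_ne_zero hu (hα i))
          have h5 : ‖u + conj (α i)‖ ≤ ‖u‖ + R := by
            refine (norm_add_le _ _).trans ?_
            rw [RCLike.norm_conj]
            linarith [hR i]
          have h6 : K * (α i).re ≤ 4 * (α i).re * u.re / ‖u + conj (α i)‖ ^ 2 := by
            have := hα i
            calc K * (α i).re = 4 * (α i).re * u.re / (‖u‖ + R) ^ 2 := by rw [hK]; ring
              _ ≤ _ := by gcongr
          have h7 := Real.add_one_le_exp (-(K * (α i).re))
          linarith
      _ = Real.exp (-(K * ∑ i ∈ J, (α i).re)) := by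
          rw [← Real.exp_sum, mul_sum, ← sum_neg_distrib]
  rw [← Real.log_le_iff_le_exp (by positivity)] at h2
  rw [le_div_iff₀ hKpos]
  linarith

end Necessity

lemma re_sub_half (s : ℂ) : (s - 1 / 2).re = s.re - 1 / 2 := by
  have : (1 / 2 : ℂ).re = 1 / 2 := by norm_num
  rw [sub_re, this]

lemma exists_laplace_eq_div {f : ℂ → ℂ} (hf : f ∈ DirichletHardy) :
    ∃ θ : L2Half, ∀ s : ℂ, 1 / 2 < s.re → f s = (s + 1 / 2) * laplace θ (s - 1 / 2) := by
  obtain ⟨φ, hφ⟩ := exists_gridTransform_eq hf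
  have hone : ∀ w : ℂ, 0 < w.re → 1 ≤ ‖w + 1‖ := by
    intro w hw
    refine le_trans ?_ (re_le_norm _)
    simp [hw.le]
  obtain ⟨M₁, -, hM₁⟩ := exists_laplace_mul (m := fun u => 1 / (u + 1)) (C := 1)
    (DifferentiableOn.div (by fun_prop) (by fun_prop) fun u hu => add_one_ne_zero_of_re_pos hu)
    zero_le_one (fun w hw => by
      rw [norm_div, norm_one, div_le_one (lt_of_lt_of_le one_pos (hone w hw))]
      exact hone w hw)
  obtain ⟨M₂, -, hM₂⟩ := exists_laplace_mul (m := fun u => u / (u + 1)) (C := 1)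
    (DifferentiableOn.div (by fun_prop) (by fun_prop) fun u hu => add_one_ne_zero_of_re_pos hu)
    zero_le_one (fun w hw => by
      rw [norm_div, div_le_one (lt_of_lt_of_le one_pos (hone w hw))]
      refine le_of_sq_le_sq ?_ (norm_nonneg _)
      rw [← normSq_eq_norm_sq, ← normSq_eq_norm_sq, normSq_apply, normSq_apply]
      simp
      nlinarith)
  refine ⟨M₁ φ + M₂ (blockTailOp one_pos φ), fun s hs => ?_⟩
  have hu : 0 < (s - 1 / 2).re := by rw [re_sub_half]; linarith
  have h1 := add_one_ne_zero_of_re_pos hu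
  rw [hφ s hs, laplace_add, hM₁ _ _ hu, hM₂ _ _ hu, gridTransform,
    show s + 1 / 2 = s - 1 / 2 + 1 by ring]
  generalize s - 1 / 2 = u at h1 ⊢
  field_simp

lemma analyticOrderAt_comp_add_const (f : ℂ → ℂ) (z c : ℂ) :
    analyticOrderAt (fun u => f (u + c)) z = analyticOrderAt f (z + c) :=
  analyticOrderAt_comp_of_deriv_ne_zero (f := f) (g := fun u => u + c) (z₀ := z) (by fun_prop)
    (by simp)

lemma summable_of_vanishesOn {ι : Type*} {S : ι → ℂ} (hS : ∀ j, 1 / 2 < (S j).re)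
    (hbdd : Bornology.IsBounded (Set.range S)) {f : ℂ → ℂ} (hf : f ∈ DirichletHardy)
    (hne : NontrivialOnHalfPlane f) (hvan : VanishesOn f S) :
    Summable fun j => (S j).re - 1 / 2 := by
  obtain ⟨θ, hθ⟩ := exists_laplace_eq_div hf
  obtain ⟨s₀, hs₀, hfs₀⟩ := hne
  obtain ⟨R, hR⟩ := isBounded_iff_forall_norm_le.1 hbdd
  have hα : ∀ j, 0 < (S j - 1 / 2).re := fun j => by rw [re_sub_half]; linarith [hS j]
  have h := summable_re_of_laplace_zeros (α := fun j => S j - 1 / 2) (R := R + 1) hα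
    (fun j => ?_) (θ := θ) ?_ (u := s₀ - 1 / 2) (by rw [re_sub_half]; linarith) ?_
  · simpa only [re_sub_half] using h
  · refine (norm_sub_le _ _).trans ?_
    have h1 := hR (S j) ⟨j, rfl⟩
    have h2 : ‖(1 / 2 : ℂ)‖ = 1 / 2 := by norm_num
    linarith
  · rintro _ ⟨j, rfl⟩
    have h1 := hvan (S j) ⟨j, rfl⟩
    have h2 : {i | S i - 1 / 2 = S j - 1 / 2} = {i | S i = S j} := by
      ext i; simp
    change {i | S i - 1 / 2 = S j - 1 / 2}.encard ≤ _
    rw [h2]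
    refine h1.trans (le_of_eq ?_)
    have h3 := analyticOrderAt_comp_add_const f (S j - 1 / 2) (1 / 2)
    rw [sub_add_cancel] at h3
    have han1 : AnalyticAt ℂ (fun u : ℂ => u + 1) (S j - 1 / 2) := by fun_prop
    have han2 : AnalyticAt ℂ (laplace θ) (S j - 1 / 2) :=
      (differentiableOn_laplace θ).analyticAt (halfPlane_mem_nhds (hα j))
    have h4 : (fun u => f (u + 1 / 2)) =ᶠ[𝓝 (S j - 1 / 2)] (fun u : ℂ => u + 1) * laplace θ := by
      filter_upwards [halfPlane_mem_nhds (hα j)] with u hu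
      have hu' : 0 < u.re := hu
      have h5 : (1 / 2 : ℝ) < (u + 1 / 2).re := by
        rw [← sub_pos, ← re_sub_half, add_sub_cancel_right]; exact hu'
      rw [hθ _ h5, Pi.mul_apply]
      ring_nf
    rw [← h3, analyticOrderAt_congr h4, analyticOrderAt_mul han1 han2,
      han1.analyticOrderAt_eq_zero.2 (add_one_ne_zero_of_re_pos (hα j)), zero_add]
  · intro h0
    exact hfs₀ (by rw [hθ s₀ hs₀, h0, mul_zero])

lemma exists_gridTransform_eq_blaschkeProd_mul {ι : Type*} {α : ι → ℂ} (hα : ∀ i, 0 < (α i).re)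
    (hsum : Summable fun i => (α i).re) {R : ℝ} (hR : ∀ i, ‖α i‖ ≤ R) :
    ∃ (N : ℕ) (hN : 0 < N) (φ : L2Half) (g : ℂ → ℂ), DifferentiableOn ℂ g {u | 0 < u.re} ∧
      (∀ u : ℂ, 0 < u.re → gridTransform hN φ u = blaschkeProd α u * g u) ∧
      ∃ u : ℂ, 0 < u.re ∧ gridTransform hN φ u ≠ 0 := by
  set B := blaschkeProd α with hB
  set R' := max R 1 with hR'
  set C : ℝ := 4 * (∑' i, (α i).re) + 4 * R' with hC
  have hR'1 : 1 ≤ R' := le_max_right _ _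
  have hsum0 : 0 ≤ ∑' i, (α i).re := tsum_nonneg fun i => (hα i).le
  have hCpos : 0 < C := by positivity
  have hmC : ∀ u : ℂ, 0 < u.re → ‖u * (1 - B u)‖ ≤ C := fun u hu =>
    norm_mul_one_sub_blaschkeProd_le hα hsum (by positivity)
      (fun i => (hR i).trans (le_max_left _ _)) hu
  have hBd := differentiableOn_blaschkeProd hα hsum
  obtain ⟨M, hM, hMl⟩ := exists_laplace_mul (m := fun u => u * (1 - B u))
    (differentiableOn_id.mul (hBd.const_sub 1)) hCpos.le hmC
  obtain ⟨M', hM', hMl'⟩ := exists_laplace_mul hBd zero_le_one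
    fun u hu => norm_blaschkeProd_le_one hα hsum hu
  set x : ℝ := C + 1 with hx
  have hx0 : 0 < (x : ℂ).re := by rw [ofReal_re]; positivity
  have hBx : B x ≠ 0 := by
    intro h0
    have h := hmC x hx0
    rw [h0, sub_zero, mul_one, norm_real, Real.norm_of_nonneg (by positivity)] at h
    linarith
  set h := expKernel x with hh
  have hLh : laplace h x = ((‖h‖ ^ 2 : ℝ) : ℂ) := by
    rw [laplace, inner_self_eq_norm_sq_to_K]; norm_cast
  have hnorm : 0 < ‖h‖ := by
    rw [norm_pos_iff]
    intro h0
    have h1 := isHardyKernel_expKernel x x hx0 hx0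
    rw [← hh, h0, inner_zero_left] at h1
    exact one_div_ne_zero (add_conj_ne_zero hx0 hx0) h1.symm
  obtain ⟨N, hN⟩ := exists_nat_gt (4 * x)
  have hxC : C < x := by linarith
  have hNR : (0 : ℝ) < N := by linarith
  have hNpos : 0 < N := by exact_mod_cast hNR
  set D := blockTailOp hNpos with hD
  have hDn : ‖D‖ ≤ 1 / N := norm_blockTailOp_le hNpos
  set A := M * D with hA
  have hAn : ‖A‖ ≤ 1 / 2 := by
    calc ‖A‖ ≤ ‖M‖ * ‖D‖ := norm_mul_le _ _
      _ ≤ C * (1 / N) := by gcongr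
      _ ≤ 1 / 2 := by rw [mul_one_div, div_le_iff₀ hNR]; linarith
  have hAlt : ‖-A‖ < 1 := by rw [norm_neg]; linarith
  obtain ⟨E, hE⟩ := (isUnit_one_sub_of_norm_lt_one hAlt)
  set φ : L2Half := (↑E⁻¹ : L2Half →L[ℂ] L2Half) (M' h) with hφ
  have heq : φ + M (D φ) = M' h := by
    have h1 : (E : L2Half →L[ℂ] L2Half) φ = M' h := by
      rw [hφ, ← mul_apply_eq_comp, Units.mul_inv, one_apply_eq_self]
    rw [hE] at h1
    simpa [hA] using h1
  have hφn : ‖φ‖ ≤ 2 * ‖h‖ := by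
    have h1 : φ = M' h - A φ := by rw [← heq, hA]; simp
    have h2 : ‖φ‖ ≤ 1 * ‖h‖ + 1 / 2 * ‖φ‖ := by
      calc ‖φ‖ = ‖M' h - A φ‖ := by rw [← h1]
        _ ≤ ‖M' h‖ + ‖A φ‖ := norm_sub_le _ _
        _ ≤ 1 * ‖h‖ + 1 / 2 * ‖φ‖ := add_le_add (M'.le_of_opNorm_le hM' h) (A.le_of_opNorm_le hAn φ)
    linarith
  have hfac : ∀ u : ℂ, 0 < u.re →
      gridTransform hNpos φ u = B u * (laplace h u + u * laplace (D φ) u) := by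
    intro u hu
    have h1 := congrArg (fun ψ => laplace ψ u) heq
    simp only [laplace_add, hMl _ _ hu, hMl' _ _ hu] at h1
    rw [gridTransform]
    linear_combination h1
  refine ⟨N, hNpos, φ, fun u => laplace h u + u * laplace (D φ) u, ?_, hfac, x, hx0, ?_⟩
  · exact (differentiableOn_laplace h).add (differentiableOn_id.mul (differentiableOn_laplace _))
  · rw [hfac x hx0]
    refine mul_ne_zero hBx fun h0 => ?_
    have h1 : ‖(x : ℂ) * laplace (D φ) x‖ = ‖h‖ ^ 2 := by
      rw [← neg_eq_iff_add_eq_zero.2 h0, norm_neg, hLh, norm_real,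
        Real.norm_of_nonneg (by positivity)]
    have h2 : ‖(x : ℂ) * laplace (D φ) x‖ ≤ x * (‖h‖ * (1 / N * (2 * ‖h‖))) := by
      rw [norm_mul, norm_real, Real.norm_of_nonneg (by positivity)]
      gcongr
      refine (norm_laplace_le _ _).trans ?_
      gcongr
      refine (D.le_of_opNorm_le hDn φ).trans ?_
      gcongr
    rw [h1] at h2
    have h3 : x * (‖h‖ * (1 / N * (2 * ‖h‖))) = (2 * x / N) * ‖h‖ ^ 2 := by ring
    have h4 : 2 * x / N < 1 := by rw [div_lt_one hNR]; linarith
    rw [h3] at h2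
    nlinarith [pow_pos hnorm 2]

lemma exists_vanishesOn_of_summable {ι : Type*} {S : ι → ℂ} (hS : ∀ j, 1 / 2 < (S j).re)
    (hbdd : Bornology.IsBounded (Set.range S)) (hsum : Summable fun j => (S j).re - 1 / 2) :
    ∃ f ∈ DirichletHardy, NontrivialOnHalfPlane f ∧ VanishesOn f S := by
  obtain ⟨R, hR⟩ := isBounded_iff_forall_norm_le.1 hbdd
  set α : ι → ℂ := fun j => S j - 1 / 2 with hα_def
  have hα : ∀ j, 0 < (α j).re := fun j => by rw [hα_def, re_sub_half]; linarith [hS j]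
  have hαsum : Summable fun j => (α j).re := by simpa only [hα_def, re_sub_half] using hsum
  have hαR : ∀ j, ‖α j‖ ≤ R + 1 := fun j => by
    refine (norm_sub_le _ _).trans ?_
    have h1 := hR (S j) ⟨j, rfl⟩
    have h2 : ‖(1 / 2 : ℂ)‖ = 1 / 2 := by norm_num
    linarith
  obtain ⟨N, hN, φ, g, hg, hfac, u₀, hu₀, hne⟩ :=
    exists_gridTransform_eq_blaschkeProd_mul hα hαsum hαR
  have hN0 : (N : ℂ) ≠ 0 := by exact_mod_cast hN.ne'
  have hpow : ∀ w : ℂ, (N : ℂ) ^ w ≠ 0 := fun w => by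
    rw [cpow_def_of_ne_zero hN0]; exact Complex.exp_ne_zero _
  refine ⟨_, gridTransform_mem_dirichletHardy hN φ, ⟨u₀ + 1 / 2, ?_, ?_⟩, ?_⟩
  · rw [← sub_pos, ← re_sub_half, add_sub_cancel_right]; exact hu₀
  · simp only [add_sub_cancel_right]
    exact mul_ne_zero (hpow _) hne
  · rintro _ ⟨j, rfl⟩
    have hfin : {i | S i = S j}.Finite := by
      have h1 := hsum.tendsto_cofinite_zero.eventually (gt_mem_nhds (sub_pos.2 (hS j)))
      refine Set.Finite.subset h1 fun i hi => ?_
      have hi' : S i = S j := hi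
      simp [hi']
    obtain ⟨J, hJ⟩ := hfin.exists_finset_coe
    have hJα : ∀ i ∈ J, α i = α j := fun i hi => by
      have : i ∈ {i | S i = S j} := by rw [← hJ]; exact hi
      have h1 : S i = S j := this
      simp only [hα_def, h1]
    have hcard := card_le_analyticOrderAt_blaschkeProd hα hαsum (hα j) hJα
    rw [← hJ, Set.encard_coe_eq_coe_finsetCard]
    refine hcard.trans ?_
    have h3 := analyticOrderAt_comp_add_const
      (fun s : ℂ => (N : ℂ) ^ (-(s - 1 / 2)) * gridTransform hN φ (s - 1 / 2)) (α j) (1 / 2)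
    rw [show α j + 1 / 2 = S j from sub_add_cancel _ _] at h3
    rw [← h3]
    have hB : AnalyticAt ℂ (blaschkeProd α) (α j) :=
      (differentiableOn_blaschkeProd hα hαsum).analyticAt (halfPlane_mem_nhds (hα j))
    have hpowd : DifferentiableOn ℂ (fun u : ℂ => (N : ℂ) ^ (-u)) {u | 0 < u.re} :=
      fun u _ => (DifferentiableAt.const_cpow (by fun_prop) (Or.inl hN0)).differentiableWithinAt
    have hG : AnalyticAt ℂ (fun u => (N : ℂ) ^ (-u) * g u) (α j) :=
      (hpowd.mul hg).analyticAt (halfPlane_mem_nhds (hα j))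
    have hcongr : (fun u : ℂ => (N : ℂ) ^ (-(u + 1 / 2 - 1 / 2)) *
        gridTransform hN φ (u + 1 / 2 - 1 / 2)) =ᶠ[𝓝 (α j)]
        blaschkeProd α * fun u => (N : ℂ) ^ (-u) * g u := by
      filter_upwards [halfPlane_mem_nhds (hα j)] with u hu
      rw [add_sub_cancel_right, hfac u hu, Pi.mul_apply]
      ring
    rw [analyticOrderAt_congr hcongr, analyticOrderAt_mul hB hG]
    exact le_self_add

theorem theorem1 {ι : Type*} [Countable ι] (S : ι → ℂ)
    (hS : ∀ j, 1 / 2 < (S j).re) (hbdd : Bornology.IsBounded (Set.range S)) :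
    (∃ f ∈ DirichletHardy, NontrivialOnHalfPlane f ∧ VanishesOn f S) ↔
      Summable (fun j => (S j).re - 1 / 2) :=
  ⟨fun ⟨_, hf, hne, hvan⟩ => summable_of_vanishesOn hS hbdd hf hne hvan,
    exists_vanishesOn_of_summable hS hbdd⟩
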